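/- **Language.** Types of probabilistic PCF (pPCF) are $\sigma,\tau ::= \iota \mid \sigma\Rightarrow\tau$. The terms are $M,N,P ::= \underline n \mid \mathsf{succ}(M)\mid\mathsf{pred}(M)\mid x\mid \mathsf{dice}(r)\mid \mathsf{let}(x,M,N)\mid \mathsf{if}(M,N,P)\mid (M)N\mid \lambda x^\sigma M\mid\mathsf{fix}(M)$ with $n\in\mathbb N$ and $r\in[0,1]\cap\mathbb Q$, typed as usual: $\underline n,\mathsf{dice}(r):\iota$; $\mathsf{succ}(M),\mathsf{pred}(M):\iota$ if $M:\iota$; $\mathsf{let}(x,M,N):\sigma$ if $M:\iota$ and $N:\sigma$ under $x:\iota$; $\mathsf{if}(M,N,P):\sigma$ if $M:\iota$ and $N,P:\sigma$; $\mathsf{fix}(M):\sigma$ if $M:\sigma\Rightarrow\sigma$; application and abstraction as in the simply typed $\lambda$-calculus. **Operational semantics.** A state is a pair $\langle M,\pi\rangle$ of a closed term and a stack of matching type, where $\pi ::= \varepsilon\mid \mathsf{arg}(N)\cdot\pi\mid\mathsf{succ}\cdot\pi\mid\mathsf{pred}\cdot\pi\mid\mathsf{if}(N,P)\cdot\pi\mid\mathsf{let}(x,N)\cdot\pi$.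 The transitions are: $\langle\mathsf{let}(x,M,N),\pi\rangle\to\langle M,\mathsf{let}(x,N)\cdot\pi\rangle$ and $\langle\underline n,\mathsf{let}(x,N)\cdot\pi\rangle\to\langle N[\underline n/x],\pi\rangle$; $\langle\mathsf{if}(M,N,P),\pi\rangle\to\langle M,\mathsf{if}(N,P)\cdot\pi\rangle$, $\langle\underline 0,\mathsf{if}(N,P)\cdot\pi\rangle\to\langle N,\pi\rangle$ and $\langle\underline{n+1},\mathsf{if}(N,P)\cdot\pi\rangle\to\langle P,\pi\rangle$; $\langle (M)N,\pi\rangle\to\langle M,\mathsf{arg}(N)\cdot\pi\rangle$ and $\langle\lambda x^\sigma M,\mathsf{arg}(N)\cdot\pi\rangle\to\langle M[N/x],\pi\rangle$; $\langle\mathsf{fix}(M),\pi\rangle\to\langle M,\mathsf{arg}(\mathsf{fix}(M))\cdot\pi\rangle$; $\langle\mathsf{succ}(M),\pi\rangle\to\langle M,\mathsf{succ}\cdot\pi\rangle$ and $\langle\underline n,\mathsf{succ}\cdot\pi\rangle\to\langle\underline{n+1},\pi\rangle$; $\langle\mathsf{pred}(M),\pi\rangle\to\langle M,\mathsf{pred}\cdot\pi\rangle$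 and $\langle\underline n,\mathsf{pred}\cdot\pi\rangle\to\langle\underline{\max(n-1,0)},\pi\rangle$; and $\langle\mathsf{dice}(r),\pi\rangle$ goes to $\langle\underline 0,\pi\rangle$ with probability $r$, consuming a bit $0$, and to $\langle\underline 1,\pi\rangle$ with probability $1-r$, consuming a bit $1$. A finite bit list $\alpha$ is successful for a state if the run choosing according to $\alpha$ reaches $\langle\underline 0,\varepsilon\rangle$ having consumed exactly $\alpha$; its weight is the product of the probabilities of its choices. For closed $M:\iota$, let $\mathbb P(M\downarrow\underline 0)$ be the sum of the weights of all bit lists that are successful for $\langle M,\varepsilon\rangle$. **Tamed distance.** Let $\Omega_\sigma=\mathsf{fix}(\lambda x^\sigma x)$. For $p\in[0,1]\cap\mathbb Q$ and closed $C:\sigma\Rightarrow\iota$ put $C^{\langle p\rangle}=\lambda z^\sigma\,(C)\,\mathsf{if}(\mathsf{dice}(p),z,\Omega_\sigma)$, and for closed $M,M':\sigma$ $$d^{\langle p\rangle}_{\mathrm{obs}}(M,M')=\sup\{\,|\mathbb P((C^{\langle p\rangle})M\downarrow\underline 0)-\mathbb P((C^{\langle p\rangle})M'\downarrow\underline 0)|\;:\;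 C:\sigma\Rightarrow\iota\text{ closed}\,\}.$$ **Denotational distance.** For a set $I$, $u,u'\in[0,\infty]^I$ and $P\subseteq[0,\infty]^I$, let $\langle u,u'\rangle=\sum_i u_iu'_i$ and $P^\perp=\{u'\mid\forall u\in P,\ \langle u,u'\rangle\le1\}$. A type $\sigma$ is interpreted by the probabilistic coherence space $(|\sigma|,\mathsf P\sigma)$ where $|\iota|=\mathbb N$, $\mathsf P\iota=\{x\mid\sum_n x_n\le1\}$, $|\sigma\Rightarrow\tau|=\mathcal M_{\mathrm{fin}}(|\sigma|)\times|\tau|$, and $\mathsf P(\sigma\Rightarrow\tau)$ is the set of the matrices $t$ such that $t\cdot v=(\sum_\mu t_{\mu,b}v_\mu)_b\in\mathsf P\tau$ for all $v\in\{x^!\mid x\in\mathsf P\sigma\}^{\perp\perp}$, where $(x^!)_\mu=x^\mu=\prod_a x_a^{\mu(a)}$. Such a $t$ is identified with the function $x\mapsto t(x)=t\cdot x^!$. A term $M:\sigma$ with variables $x_1:\sigma_1,\dots,x_k:\sigma_k$ is interpreted by a family (indexed by $|\sigma|$) of power series in $u_1\in\mathsf P\sigma_1,\dots,u_k\in\mathsf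 P\sigma_k$: with $e_n$ the Dirac vector at $n$, $[\![x_i]\!](u)=u_i$, $[\![\underline n]\!](u)=e_n$, $[\![\mathsf{succ}(M)]\!](u)=\sum_n[\![M]\!](u)_n\,e_{n+1}$, $[\![\mathsf{pred}(M)]\!](u)=\sum_n[\![M]\!](u)_n\,e_{\max(n-1,0)}$, $[\![\mathsf{dice}(r)]\!](u)=r\,e_0+(1-r)\,e_1$, $[\![\mathsf{let}(x,M,N)]\!](u)=\sum_n[\![M]\!](u)_n\,[\![N]\!](u,e_n)$, $[\![\mathsf{if}(M,N,P)]\!](u)=[\![M]\!](u)_0\,[\![N]\!](u)+\big(\sum_n[\![M]\!](u)_{n+1}\big)[\![P]\!](u)$, $[\![(M)N]\!](u)=[\![M]\!](u)([\![N]\!](u))$, $[\![\mathsf{fix}(M)]\!](u)=\sup_n([\![M]\!](u))^n(0)$, and abstraction is currying. In particular a closed $M:\sigma$ is interpreted by an element $[\![M]\!]$ of $\mathsf P\sigma$. For $x,y\in\mathsf P\sigma$ let $d_{[\![\sigma]\!]}(x,y)=\|x-x\wedge y\|+\|y-x\wedge y\|$, where $x\wedge y$ is the pointwise minimum and $\|z\|=\inf\{r>0\mid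 z\in r\,\mathsf P\sigma\}$. **Theorem.** Let $p\in[0,1)\cap\mathbb Q$ and let $M,M'$ be closed pPCF terms of type $\sigma$. Then $$d^{\langle p\rangle}_{\mathrm{obs}}(M,M')\;\le\;\frac{p}{1-p}\;d_{[\![\sigma]\!]}([\![M]\!],[\![M']\!]).$$ -/

import Mathlib

open scoped ENNReal NNReal

namespace PPCF

/-! ## Syntax: intrinsically typed terms with de Bruijn indices -/

/-- Types `σ, τ ::= ι | σ ⇒ τ`. -/
inductive Ty : Type
  | nat : Ty
  | arr : Ty → Ty → Ty

/-- Typing contexts. -/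
abbrev Ctx : Type := List Ty

/-- `Var Γ σ`: the variables of type `σ` declared in `Γ`. -/
inductive Var : Ctx → Ty → Type
  | zero {Γ : Ctx} {σ : Ty} : Var (σ :: Γ) σ
  | succ {Γ : Ctx} {σ τ : Ty} : Var Γ σ → Var (τ :: Γ) σ

/-- The parameters `r ∈ [0,1] ∩ ℚ` of the coins. -/
abbrev Coin : Type := Set.Icc (0 : ℚ) 1

/-- `Tm Γ σ`: the terms `M` with `Γ ⊢ M : σ`. -/
inductive Tm : Ctx → Ty → Type
  | num {Γ : Ctx} (n : ℕ) : Tm Γ .nat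
  | succ {Γ : Ctx} (M : Tm Γ .nat) : Tm Γ .nat
  | pred {Γ : Ctx} (M : Tm Γ .nat) : Tm Γ .nat
  | var {Γ : Ctx} {σ : Ty} (x : Var Γ σ) : Tm Γ σ
  | dice {Γ : Ctx} (r : Coin) : Tm Γ .nat
  | letin {Γ : Ctx} {σ : Ty} (M : Tm Γ .nat) (N : Tm (.nat :: Γ) σ) : Tm Γ σ
  | ifz {Γ : Ctx} {σ : Ty} (M : Tm Γ .nat) (N P : Tm Γ σ) : Tm Γ σ
  | app {Γ : Ctx} {σ τ : Ty} (M : Tm Γ (.arr σ τ)) (N : Tm Γ σ) : Tm Γ τ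
  | lam {Γ : Ctx} {σ τ : Ty} (M : Tm (σ :: Γ) τ) : Tm Γ (.arr σ τ)
  | fix {Γ : Ctx} {σ : Ty} (M : Tm Γ (.arr σ σ)) : Tm Γ σ

/-- Closed terms of type `σ`. -/
abbrev Closed (σ : Ty) : Type := Tm [] σ

/-- Renamings. -/
abbrev Ren (Γ Δ : Ctx) : Type := ∀ ⦃σ : Ty⦄, Var Γ σ → Var Δ σ

/-- Extension of a renaming under a binder. -/
def Ren.lift {Γ Δ : Ctx} (ρ : Ren Γ Δ) (τ : Ty) : Ren (τ :: Γ) (τ :: Δ)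
  | _, .zero => .zero
  | _, .succ x => .succ (ρ x)

/-- Action of a renaming on a term. -/
def Tm.rename : ∀ {Γ Δ : Ctx} {σ : Ty}, Ren Γ Δ → Tm Γ σ → Tm Δ σ
  | _, _, _, _, .num n => .num n
  | _, _, _, ρ, .succ M => .succ (M.rename ρ)
  | _, _, _, ρ, .pred M => .pred (M.rename ρ)
  | _, _, _, ρ, .var x => .var (ρ x)
  | _, _, _, _, .dice r => .dice r
  | _, _, _, ρ, .letin M N => .letin (M.rename ρ) (N.rename (ρ.lift _))
  | _, _, _, ρ, .ifz M N P => .ifz (M.rename ρ) (N.rename ρ) (P.rename ρ)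
  | _, _, _, ρ, .app M N => .app (M.rename ρ) (N.rename ρ)
  | _, _, _, ρ, .lam M => .lam (M.rename (ρ.lift _))
  | _, _, _, ρ, .fix M => .fix (M.rename ρ)

/-- Weakening by one variable. -/
def Tm.weaken {Γ : Ctx} {σ : Ty} (τ : Ty) (M : Tm Γ σ) : Tm (τ :: Γ) σ :=
  M.rename (fun _ x => .succ x)

/-- Simultaneous substitutions. -/
abbrev Sub (Γ Δ : Ctx) : Type := ∀ ⦃σ : Ty⦄, Var Γ σ → Tm Δ σ

/-- Extension of a substitution under a binder. -/
def Sub.lift {Γ Δ : Ctx} (s : Sub Γ Δ) (τ : Ty) : Sub (τ :: Γ) (τ :: Δ)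
  | _, .zero => .var .zero
  | _, .succ x => (s x).weaken τ

/-- Capture-free simultaneous substitution. -/
def Tm.subst : ∀ {Γ Δ : Ctx} {σ : Ty}, Sub Γ Δ → Tm Γ σ → Tm Δ σ
  | _, _, _, _, .num n => .num n
  | _, _, _, s, .succ M => .succ (M.subst s)
  | _, _, _, s, .pred M => .pred (M.subst s)
  | _, _, _, s, .var x => s x
  | _, _, _, _, .dice r => .dice r
  | _, _, _, s, .letin M N => .letin (M.subst s) (N.subst (s.lift _))
  | _, _, _, s, .ifz M N P => .ifz (M.subst s) (N.subst s) (P.subst s)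
  | _, _, _, s, .app M N => .app (M.subst s) (N.subst s)
  | _, _, _, s, .lam M => .lam (M.subst (s.lift _))
  | _, _, _, s, .fix M => .fix (M.subst s)

/-- The substitution of `N` for the last variable. -/
def Sub.single {Γ : Ctx} {τ : Ty} (N : Tm Γ τ) : Sub (τ :: Γ) Γ
  | _, .zero => N
  | _, .succ x => .var x

/-- `M[N/x]`, where `x` is the last variable of the context of `M`. -/
def Tm.inst {Γ : Ctx} {σ τ : Ty} (M : Tm (τ :: Γ) σ) (N : Tm Γ τ) : Tm Γ σ :=
  M.subst (Sub.single N)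

/-! ## Operational semantics: a stack machine reading a finite list of random bits -/

/-- `Stack σ`: the stacks taking a closed term of type `σ` and returning an integer. -/
inductive Stack : Ty → Type
  | nil : Stack .nat
  | arg {σ τ : Ty} (N : Closed σ) (π : Stack τ) : Stack (.arr σ τ)
  | succ (π : Stack .nat) : Stack .nat
  | pred (π : Stack .nat) : Stack .nat
  | ifz {σ : Ty} (N P : Closed σ) (π : Stack σ) : Stack .nat
  | letin {σ : Ty} (N : Tm [.nat] σ) (π : Stack σ) : Stack .nat

/-- States `⟨M, π⟩` of the machine. -/
structure State : Type where
  ty : Ty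
  tm : Closed ty
  stack : Stack ty

/-- What a state does next: successful end (the numeral `0` on the empty stack), blocked (a nonzero
numeral on the empty stack), a deterministic transition, or a coin toss with parameter `r`. -/
inductive Outcome : Type
  | halt : Outcome
  | stuck : Outcome
  | next (s : State) : Outcome
  | toss (r : Coin) (s₀ s₁ : State) : Outcome

/-- One transition of the machine. -/
def step : {σ : Ty} → Closed σ → Stack σ → Outcome
  | _, .letin M N, π => .next ⟨_, M, .letin N π⟩
  | _, .ifz M N P, π => .next ⟨_, M, .ifz N P π⟩
  | _, .app M N, π => .next ⟨_, M, .arg N π⟩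
  | _, .fix M, π => .next ⟨_, M, .arg (.fix M) π⟩
  | _, .succ M, π => .next ⟨_, M, .succ π⟩
  | _, .pred M, π => .next ⟨_, M, .pred π⟩
  | _, .dice r, π => .toss r ⟨_, .num 0, π⟩ ⟨_, .num 1, π⟩
  | _, .lam M, .arg N π => .next ⟨_, M.inst N, π⟩
  | _, .num n, .letin N π => .next ⟨_, N.inst (.num n), π⟩
  | _, .num 0, .ifz N _ π => .next ⟨_, N, π⟩
  | _, .num (_ + 1), .ifz _ P π => .next ⟨_, P, π⟩
  | _, .num n, .succ π => .next ⟨_, .num (n + 1), π⟩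
  | _, .num n, .pred π => .next ⟨_, .num (n - 1), π⟩
  | _, .num 0, .nil => .halt
  | _, .num (_ + 1), .nil => .stuck

/-- The next outcome of a state. -/
def State.step (s : State) : Outcome := PPCF.step s.tm s.stack

/-- The probability `r` that a coin of parameter `r` yields `0`. -/
noncomputable def Coin.prob₀ (r : Coin) : ℝ≥0 := Real.toNNReal ((r : ℚ) : ℝ)

/-- The probability `1 - r` that a coin of parameter `r` yields `1`. -/
noncomputable def Coin.prob₁ (r : Coin) : ℝ≥0 := Real.toNNReal (1 - ((r : ℚ) : ℝ))

/-- `Eval s α w`: reading exactly the list of bits `α` (`false` for `0`, `true` for `1`), the state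
`s` reaches the numeral `0` on the empty stack, and the choices `α` have probability `w`. -/
inductive Eval : State → List Bool → ℝ≥0 → Prop
  | halt {s : State} (h : s.step = .halt) : Eval s [] 1
  | next {s s' : State} {α : List Bool} {w : ℝ≥0} (h : s.step = .next s') (h' : Eval s' α w) :
      Eval s α w
  | toss₀ {s s₀ s₁ : State} {r : Coin} {α : List Bool} {w : ℝ≥0} (h : s.step = .toss r s₀ s₁)
      (h' : Eval s₀ α w) : Eval s (false :: α) (w * r.prob₀)
  | toss₁ {s s₀ s₁ : State} {r : Coin} {α : List Bool} {w : ℝ≥0} (h : s.step = .toss r s₀ s₁)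
      (h' : Eval s₁ α w) : Eval s (true :: α) (w * r.prob₁)

/-- `Eval` is the graph of a partial function. -/
theorem Eval.unique {s : State} {α : List Bool} {w w' : ℝ≥0} (h : Eval s α w)
    (h' : Eval s α w') : w = w' := by
  induction h generalizing w' with
  | halt h => cases h' <;> simp_all
  | next h _ ih =>
    cases h' with
    | next g g' => rw [h] at g; cases g; exact ih g'
    | _ => simp_all
  | toss₀ h _ ih =>
    cases h' with
    | next g _ => simp_all
    | toss₀ g g' => rw [h] at g; cases g; rw [ih g']
  | toss₁ h _ ih =>
    cases h' with
    | next g _ => simp_all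
    | toss₁ g g' => rw [h] at g; cases g; rw [ih g']

/-- The partial evaluation function from states and finite lists of bits to weights. -/
noncomputable def ev (s : State) (α : List Bool) : Part ℝ≥0 :=
  ⟨∃ w, Eval s α w, fun h => h.choose⟩

/-- The lists of bits on which the evaluation of `s` is defined. -/
def evDom (s : State) : Set (List Bool) := {α | (ev s α).Dom}

/-- The probability that the evaluation of the state `s` converges to `0`. -/
noncomputable def State.convProb (s : State) : ℝ≥0∞ :=
  ∑' α : evDom s, (((ev s α.1).get α.2 : ℝ≥0) : ℝ≥0∞)

/-- The weight of a list of bits, for the machine stopped after `n` steps. -/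
noncomputable def evFuel : ℕ → State → List Bool → ℝ≥0∞
  | 0, _, _ => 0
  | n + 1, s, α =>
    match s.step, α with
    | .halt, [] => 1
    | .next s', α => evFuel n s' α
    | .toss r s₀ _, false :: α => evFuel n s₀ α * (r.prob₀ : ℝ≥0∞)
    | .toss r _ s₁, true :: α => evFuel n s₁ α * (r.prob₁ : ℝ≥0∞)
    | _, _ => 0

theorem Eval.evFuel_eq {s : State} {α : List Bool} {w : ℝ≥0} (h : Eval s α w) :
    ∃ N, ∀ n, N ≤ n → evFuel n s α = w := by
  induction h with
  | halt h =>
    refine ⟨1, fun n hn => ?_⟩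
    obtain ⟨n, rfl⟩ := Nat.exists_eq_add_of_le' hn
    simp [evFuel, h]
  | next h _ ih =>
    obtain ⟨N, ih⟩ := ih
    refine ⟨N + 1, fun n hn => ?_⟩
    obtain ⟨n, rfl⟩ := Nat.exists_eq_add_of_le' (le_trans (Nat.le_add_left 1 N) hn)
    simp [evFuel, h, ih n (by omega)]
  | toss₀ h _ ih =>
    obtain ⟨N, ih⟩ := ih
    refine ⟨N + 1, fun n hn => ?_⟩
    obtain ⟨n, rfl⟩ := Nat.exists_eq_add_of_le' (le_trans (Nat.le_add_left 1 N) hn)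
    simp [evFuel, h, ih n (by omega)]
  | toss₁ h _ ih =>
    obtain ⟨N, ih⟩ := ih
    refine ⟨N + 1, fun n hn => ?_⟩
    obtain ⟨n, rfl⟩ := Nat.exists_eq_add_of_le' (le_trans (Nat.le_add_left 1 N) hn)
    simp [evFuel, h, ih n (by omega)]

theorem Coin.prob_add (r : Coin) : (r.prob₀ : ℝ≥0∞) + r.prob₁ = 1 := by
  have h₀ : (0 : ℝ) ≤ ((r : ℚ) : ℝ) := by exact_mod_cast r.2.1
  have h₁ : ((r : ℚ) : ℝ) ≤ 1 := by exact_mod_cast r.2.2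
  rw [← ENNReal.coe_add, Coin.prob₀, Coin.prob₁, ← Real.toNNReal_add h₀ (by linarith)]
  simp

theorem tsum_evFuel_le_one (n : ℕ) : ∀ s, ∑' α, evFuel n s α ≤ 1 := by
  induction n with
  | zero => intro s; simp [evFuel]
  | succ n ih =>
    intro s
    cases h : s.step with
    | halt =>
      rw [tsum_eq_single []]
      · simp [evFuel, h]
      · rintro (_ | ⟨b, α⟩) hα
        · exact absurd rfl hα
        · simp [evFuel, h]
    | stuck =>
      have : ∀ α, evFuel (n + 1) s α = 0 := fun α => by simp [evFuel, h]
      simp [this]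
    | next s' =>
      have : ∀ α, evFuel (n + 1) s α = evFuel n s' α := fun α => by simp [evFuel, h]
      simpa [this] using ih s'
    | toss r s₀ s₁ =>
      have hinj : Function.Injective fun q : Bool × List Bool => q.1 :: q.2 := by
        rintro ⟨a, α⟩ ⟨b, β⟩ hab
        simpa using hab
      rw [← hinj.tsum_eq, ENNReal.tsum_prod', tsum_bool]
      · have e₀ : ∀ α, evFuel (n + 1) s (false :: α) = evFuel n s₀ α * (r.prob₀ : ℝ≥0∞) :=
          fun α => by simp [evFuel, h]
        have e₁ : ∀ α, evFuel (n + 1) s (true :: α) = evFuel n s₁ α * (r.prob₁ : ℝ≥0∞) :=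
          fun α => by simp [evFuel, h]
        simp only [e₀, e₁, ENNReal.tsum_mul_right]
        calc _ ≤ 1 * (r.prob₀ : ℝ≥0∞) + 1 * (r.prob₁ : ℝ≥0∞) := by
              gcongr
              · exact ih s₀
              · exact ih s₁
          _ = 1 := by rw [one_mul, one_mul, r.prob_add]
      · rintro (_ | ⟨b, α⟩) hα
        · simp [evFuel, h] at hα
        · exact ⟨(b, α), rfl⟩

/-- The weights of the successful runs add up to at most `1`. -/
theorem State.convProb_le_one (s : State) : s.convProb ≤ 1 := by
  rw [State.convProb, ENNReal.tsum_eq_iSup_sum]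
  refine iSup_le fun F => ?_
  have key : ∀ α : evDom s, ∃ N, ∀ n, N ≤ n →
      evFuel n s α.1 = (((ev s α.1).get α.2 : ℝ≥0) : ℝ≥0∞) :=
    fun α => Eval.evFuel_eq (Exists.choose_spec α.2)
  choose N hN using key
  calc _ = ∑ α ∈ F, evFuel (F.sup N) s α.1 :=
        Finset.sum_congr rfl fun α hα => (hN α _ (Finset.le_sup hα)).symm
    _ ≤ ∑' α : evDom s, evFuel (F.sup N) s α.1 := ENNReal.sum_le_tsum F
    _ ≤ ∑' α, evFuel (F.sup N) s α :=
        ENNReal.tsum_comp_le_tsum_of_injective Subtype.val_injective _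
    _ ≤ 1 := tsum_evFuel_le_one _ s

/-- The probability that a closed term of ground type reduces to `0`. -/
noncomputable def probZero (M : Closed .nat) : ℝ :=
  (State.convProb ⟨.nat, M, .nil⟩).toReal

/-! ## The tamed observational distance -/

/-- The ever looping term `fix (λ x^σ. x)`. -/
def loop {Γ : Ctx} (σ : Ty) : Tm Γ σ := .fix (.lam (.var .zero))

/-- The tamed context `λ z^σ. C (if (dice p) z loop)`. -/
def tamed {σ : Ty} (p : Coin) (C : Closed (.arr σ .nat)) : Closed (.arr σ .nat) :=
  .lam (.app (C.weaken σ) (.ifz (.dice p) (.var .zero) (loop σ)))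

/-- The `p`-tamed observational distance. -/
noncomputable def tamedObsDist {σ : Ty} (p : Coin) (M M' : Closed σ) : ℝ :=
  sSup {d : ℝ | ∃ C : Closed (.arr σ .nat),
    d = |probZero (.app (tamed p C) M) - probZero (.app (tamed p C) M')|}

theorem probZero_mem (M : Closed .nat) : probZero M ∈ Set.Icc (0 : ℝ) 1 :=
  ⟨ENNReal.toReal_nonneg,
    ENNReal.toReal_le_of_le_ofReal zero_le_one (by simpa using State.convProb_le_one _)⟩

/-- The supremum defining the tamed distance is the one of a bounded set. -/
theorem tamedObsDist_isLUB {σ : Ty} (p : Coin) (M M' : Closed σ) :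
    IsLUB {d : ℝ | ∃ C : Closed (.arr σ .nat),
      d = |probZero (.app (tamed p C) M) - probZero (.app (tamed p C) M')|}
      (tamedObsDist p M M') := by
  refine isLUB_csSup ⟨_, .lam (.num 0), rfl⟩ ⟨1, ?_⟩
  rintro _ ⟨C, rfl⟩
  have h := probZero_mem (.app (tamed p C) M)
  have h' := probZero_mem (.app (tamed p C) M')
  rw [abs_le]
  constructor <;> linarith [h.1, h.2, h'.1, h'.2]

/-! ## Probabilistic coherence spaces -/

/-- The pairing `⟨u, u'⟩ = ∑ᵢ uᵢ u'ᵢ`. -/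
noncomputable def pairing {I : Type} (u u' : I → ℝ≥0∞) : ℝ≥0∞ := ∑' i, u i * u' i

/-- The orthogonal of `P`. -/
def orth {I : Type} (P : Set (I → ℝ≥0∞)) : Set (I → ℝ≥0∞) := {u' | ∀ u ∈ P, pairing u u' ≤ 1}

/-- `(I, P)` is a probabilistic coherence space. -/
structure IsPCS {I : Type} (P : Set (I → ℝ≥0∞)) : Prop where
  countable : Countable I
  biorth : orth (orth P) = P
  pos : ∀ a, ∃ x ∈ P, 0 < x a
  bdd : ∀ a, ∃ m : ℝ≥0, ∀ x ∈ P, x a ≤ m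

/-- Application of a matrix to a vector. -/
noncomputable def matApp {I J : Type} (t : I × J → ℝ≥0∞) (u : I → ℝ≥0∞) : J → ℝ≥0∞ :=
  fun j => ∑' i, t (i, j) * u i

/-- The space of linear morphisms from `P` to `Q`. -/
def linSpace {I J : Type} (P : Set (I → ℝ≥0∞)) (Q : Set (J → ℝ≥0∞)) : Set (I × J → ℝ≥0∞) :=
  {t | ∀ x ∈ P, matApp t x ∈ Q}

/-- The promotion of a vector; finite multisets are finitely supported maps `μ : I → ℕ`. -/
noncomputable def promotion {I : Type} (x : I → ℝ≥0∞) : (I →₀ ℕ) → ℝ≥0∞ :=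
  fun μ => μ.prod fun a k => x a ^ k

/-- The exponential of a space. -/
def exclSpace {I : Type} (P : Set (I → ℝ≥0∞)) : Set ((I →₀ ℕ) → ℝ≥0∞) :=
  orth (orth (promotion '' P))

/-- The sub-probability distributions on `ℕ`. -/
def natSpace : Set (ℕ → ℝ≥0∞) := {x | ∑' n, x n ≤ 1}

/-- The norm `inf {r > 0 | x ∈ r P}` of the cone spanned by `P`. -/
noncomputable def coneNorm {I : Type} (P : Set (I → ℝ≥0∞)) (x : I → ℝ≥0∞) : ℝ :=
  sInf {r : ℝ | 0 < r ∧ ∃ y ∈ P, x = fun a => ENNReal.ofReal r * y a}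

/-- The distance `‖x - x ∧ y‖ + ‖y - x ∧ y‖` on `P` (all operations on vectors are pointwise). -/
noncomputable def pcsDist {I : Type} (P : Set (I → ℝ≥0∞)) (x y : I → ℝ≥0∞) : ℝ :=
  coneNorm P (x - x ⊓ y) + coneNorm P (y - x ⊓ y)

theorem pairing_mono {I : Type} {u v w : I → ℝ≥0∞} (h : u ≤ v) : pairing u w ≤ pairing v w :=
  ENNReal.tsum_le_tsum fun i => mul_le_mul_left (h i) _

theorem pairing_comm {I : Type} (u v : I → ℝ≥0∞) : pairing u v = pairing v u := by
  simp [pairing, mul_comm]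

theorem subset_biorth {I : Type} (P : Set (I → ℝ≥0∞)) : P ⊆ orth (orth P) :=
  fun u hu v hv => by rw [pairing_comm]; exact hv u hu

theorem orth_anti {I : Type} {P Q : Set (I → ℝ≥0∞)} (h : P ⊆ Q) : orth Q ⊆ orth P :=
  fun _ hu v hv => hu v (h hv)

theorem triorth {I : Type} (P : Set (I → ℝ≥0∞)) : orth (orth (orth P)) = orth P :=
  Set.Subset.antisymm (orth_anti (subset_biorth P)) (subset_biorth _)

theorem pairing_single {I : Type} [DecidableEq I] (a : I) (c : ℝ≥0∞) (u : I → ℝ≥0∞) :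
    pairing u (Pi.single a c) = u a * c := by
  rw [pairing, tsum_eq_single a]
  · simp
  · intro b hb
    simp [hb]

theorem isPCS_natSpace : IsPCS natSpace := by
  have h : natSpace = orth {fun _ => 1} := by
    ext x; simp [natSpace, orth, pairing]
  refine ⟨inferInstance, by rw [h, triorth], fun a => ⟨Pi.single a 1, ?_, by simp⟩,
    fun a => ⟨1, fun x hx => ?_⟩⟩
  · rw [h]
    rintro _ rfl
    rw [pairing_single]
    simp
  · exact le_trans (ENNReal.le_tsum a) hx

theorem IsPCS.lower {I : Type} {P : Set (I → ℝ≥0∞)} (h : IsPCS P) {x y : I → ℝ≥0∞} (hxy : x ≤ y)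
    (hy : y ∈ P) : x ∈ P := by
  rw [← h.biorth] at hy ⊢
  intro u hu
  rw [pairing_comm]
  exact (pairing_mono hxy).trans (by rw [pairing_comm]; exact hy u hu)

theorem pairing_matApp {I J : Type} (t : I × J → ℝ≥0∞) (x : I → ℝ≥0∞) (y : J → ℝ≥0∞) :
    pairing y (matApp t x) = pairing (fun q : I × J => x q.1 * y q.2) t := by
  simp only [pairing, matApp]
  rw [ENNReal.tsum_prod', ENNReal.tsum_comm]
  refine tsum_congr fun j => ?_
  rw [← ENNReal.tsum_mul_left]
  refine tsum_congr fun i => ?_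
  ring

theorem isPCS_linSpace {I J : Type} {P : Set (I → ℝ≥0∞)} {Q : Set (J → ℝ≥0∞)} (hP : IsPCS P)
    (hQ : IsPCS Q) : IsPCS (linSpace P Q) := by
  classical
  have := hP.countable
  have := hQ.countable
  have h : linSpace P Q =
      orth {z | ∃ x ∈ P, ∃ y ∈ orth Q, z = fun q : I × J => x q.1 * y q.2} := by
    ext t
    constructor
    · rintro ht _ ⟨x, hx, y, hy, rfl⟩
      rw [← pairing_matApp, pairing_comm]
      exact hy _ (ht x hx)
    · intro ht x hx
      rw [← hQ.biorth]
      intro y hy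
      rw [pairing_matApp]
      exact ht _ ⟨x, hx, y, hy, rfl⟩
  refine ⟨inferInstance, by rw [h, triorth], ?_, ?_⟩
  · rintro ⟨a, b⟩
    obtain ⟨m, hm⟩ := hP.bdd a
    obtain ⟨y, hy, hyb⟩ := hQ.pos b
    have hc : ((max m 1 : ℝ≥0) : ℝ≥0∞) ≠ 0 := by
      rw [Ne, ENNReal.coe_eq_zero]
      exact (lt_of_lt_of_le zero_lt_one (le_max_right m 1)).ne'
    refine ⟨fun q => if q.1 = a then ((max m 1 : ℝ≥0) : ℝ≥0∞)⁻¹ * y q.2 else 0, ?_, ?_⟩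
    · intro x hx
      refine hQ.lower (fun j => ?_) hy
      rw [matApp, tsum_eq_single a (fun i hi => by simp [hi])]
      have hx' : x a ≤ ((max m 1 : ℝ≥0) : ℝ≥0∞) :=
        (hm x hx).trans (ENNReal.coe_le_coe.2 (le_max_left m 1))
      calc _ = (((max m 1 : ℝ≥0) : ℝ≥0∞)⁻¹ * x a) * y j := by simp; ring
        _ ≤ (((max m 1 : ℝ≥0) : ℝ≥0∞)⁻¹ * ((max m 1 : ℝ≥0) : ℝ≥0∞)) * y j := by gcongr
        _ = y j := by rw [ENNReal.inv_mul_cancel hc ENNReal.coe_ne_top, one_mul]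
    · simp only [if_true]
      exact ENNReal.mul_pos (ENNReal.inv_ne_zero.2 ENNReal.coe_ne_top) hyb.ne'
  · rintro ⟨a, b⟩
    obtain ⟨x, hx, hxa⟩ := hP.pos a
    obtain ⟨m, hm⟩ := hQ.bdd b
    have hfin : (m : ℝ≥0∞) / x a ≠ ⊤ := ENNReal.div_ne_top ENNReal.coe_ne_top hxa.ne'
    obtain ⟨c, hc⟩ := hP.bdd a
    have hxt : x a ≠ ⊤ := ne_top_of_le_ne_top ENNReal.coe_ne_top (hc x hx)
    refine ⟨((m : ℝ≥0∞) / x a).toNNReal, fun t ht => ?_⟩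
    rw [ENNReal.coe_toNNReal hfin, ENNReal.le_div_iff_mul_le (Or.inl hxa.ne') (Or.inl hxt)]
    exact le_trans (ENNReal.le_tsum (f := fun i => t (i, b) * x i) a) (hm _ (ht x hx))

theorem IsPCS.exists_pos_on {I : Type} {P : Set (I → ℝ≥0∞)} (h : IsPCS P) (F : Finset I) :
    ∃ x ∈ P, ∀ a ∈ F, 0 < x a := by
  classical
  induction F using Finset.induction_on with
  | empty =>
    refine ⟨0, ?_, by simp⟩
    rw [← h.biorth]
    intro u _
    simp [pairing]
  | insert a F _ ih =>
    obtain ⟨x, hx, hx'⟩ := ih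
    obtain ⟨y, hy, hy'⟩ := h.pos a
    have hpos : ∀ c : ℝ≥0∞, 0 < c → 0 < 2⁻¹ * c := fun c hc =>
      ENNReal.mul_pos (by simp) hc.ne'
    refine ⟨fun i => 2⁻¹ * x i + 2⁻¹ * y i, ?_, fun b hb => ?_⟩
    · rw [← h.biorth] at hx hy ⊢
      intro u hu
      have e : pairing u (fun i => 2⁻¹ * x i + 2⁻¹ * y i) =
          2⁻¹ * pairing u x + 2⁻¹ * pairing u y := by
        simp only [pairing]
        rw [← ENNReal.tsum_mul_left, ← ENNReal.tsum_mul_left, ← ENNReal.tsum_add]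
        refine tsum_congr fun i => ?_
        ring
      rw [e]
      calc _ ≤ (2⁻¹ : ℝ≥0∞) * 1 + 2⁻¹ * 1 := by
            gcongr
            · exact hx u hu
            · exact hy u hu
        _ = 1 := by rw [mul_one, ENNReal.inv_two_add_inv_two]
    · rcases Finset.mem_insert.1 hb with rfl | hb
      · exact lt_of_lt_of_le (hpos _ hy') le_add_self
      · exact lt_of_lt_of_le (hpos _ (hx' b hb)) le_self_add

theorem isPCS_exclSpace {I : Type} {P : Set (I → ℝ≥0∞)} (hP : IsPCS P) : IsPCS (exclSpace P) := by
  classical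
  have := hP.countable
  refine ⟨inferInstance, by rw [exclSpace, triorth], fun μ => ?_, fun μ => ?_⟩
  · obtain ⟨x, hx, hx'⟩ := hP.exists_pos_on μ.support
    refine ⟨promotion x, subset_biorth _ ⟨x, hx, rfl⟩, ?_⟩
    rw [pos_iff_ne_zero, promotion, Finsupp.prod, Finset.prod_ne_zero_iff]
    exact fun a ha => pow_ne_zero _ (hx' a ha).ne'
  · choose m hm using hP.bdd
    set c : ℝ≥0 := max (μ.prod fun a k => m a ^ k) 1 with hc
    have hc0 : (c : ℝ≥0∞) ≠ 0 := by
      rw [Ne, ENNReal.coe_eq_zero]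
      exact (lt_of_lt_of_le zero_lt_one (le_max_right _ 1)).ne'
    refine ⟨c, fun u hu => ?_⟩
    have hmem : (Pi.single μ (c : ℝ≥0∞)⁻¹ : (I →₀ ℕ) → ℝ≥0∞) ∈ orth (promotion '' P) := by
      rintro _ ⟨x, hx, rfl⟩
      rw [pairing_single, ← div_eq_mul_inv]
      refine ENNReal.div_le_of_le_mul ?_
      rw [one_mul]
      refine le_trans ?_ (ENNReal.coe_le_coe.2 (le_max_left _ 1))
      rw [promotion, Finsupp.prod, Finsupp.prod, ENNReal.ofNNReal_finsetProd]
      refine Finset.prod_le_prod' fun a _ => ?_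
      rw [ENNReal.coe_pow]
      exact pow_le_pow_left' (hm a x hx) _
    have := hu _ hmem
    rw [pairing_comm, pairing_single, ← div_eq_mul_inv,
      ENNReal.div_le_iff hc0 ENNReal.coe_ne_top, one_mul] at this
    exact this

/-! ## Denotational semantics -/

/-- The web of the interpretation of a type. -/
@[reducible] def Web : Ty → Type
  | .nat => ℕ
  | .arr σ τ => (Web σ →₀ ℕ) × Web τ

/-- The probabilistic coherence space interpreting a type: `⟦ι⟧` is the space of sub-probability
distributions on `ℕ`, and `⟦σ ⇒ τ⟧` is `!⟦σ⟧ ⊸ ⟦τ⟧`. -/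
def tySem : (σ : Ty) → Set (Web σ → ℝ≥0∞)
  | .nat => natSpace
  | .arr σ τ => linSpace (exclSpace (tySem σ)) (tySem τ)

/-- Types are interpreted by probabilistic coherence spaces. -/
theorem isPCS_tySem : ∀ σ, IsPCS (tySem σ)
  | .nat => isPCS_natSpace
  | .arr σ τ => isPCS_linSpace (isPCS_exclSpace (isPCS_tySem σ)) (isPCS_tySem τ)

/-- The web of the cartesian product interpreting a context. -/
@[reducible] def CtxWeb : Ctx → Type
  | [] => Empty
  | σ :: Γ => Web σ ⊕ CtxWeb Γ

/-- A power series in variables indexed by the web of `Γ`, with coefficients in `[0, ∞]`. -/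
abbrev Series (Γ : Ctx) : Type := MvPowerSeries (CtxWeb Γ) ℝ≥0∞

/-- The matrices in `(CtxWeb Γ →₀ ℕ) × Web σ`, of which the Kleisli morphisms from `⟦Γ⟧` to `⟦σ⟧`
are a part, presented as families of power series (one for each element of the web of `σ`). -/
abbrev Mor (Γ : Ctx) (σ : Ty) : Type := Web σ → Series Γ

/-- Sum of a family of power series, coefficient by coefficient. -/
noncomputable def Series.sum {Γ : Ctx} {ι : Type} (f : ι → Series Γ) : Series Γ :=
  fun m => ∑' i, f i m

/-- The projection interpreting a variable. -/
def Var.inWeb : {Γ : Ctx} → {σ : Ty} → Var Γ σ → Web σ → CtxWeb Γ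
  | _, _, .zero, a => Sum.inl a
  | _, _, .succ x, a => Sum.inr (x.inWeb a)

/-- The numeral `n`. -/
noncomputable def Mor.num {Γ : Ctx} (n : ℕ) : Mor Γ .nat :=
  fun (k : ℕ) => if k = n then 1 else 0

/-- Composition with the linear morphism `δ(f n, k)` induced by a function `f` on integers. -/
noncomputable def Mor.mapNat {Γ : Ctx} (f : ℕ → ℕ) (A : Mor Γ .nat) : Mor Γ .nat :=
  fun (k : ℕ) => Series.sum fun n : ℕ => if f n = k then A n else 0

/-- The coin `r · 0 + (1 - r) · 1`. -/
noncomputable def Mor.dice {Γ : Ctx} (r : Coin) : Mor Γ .nat :=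
  fun (k : ℕ) => MvPowerSeries.C
    (if k = 0 then (r.prob₀ : ℝ≥0∞) else if k = 1 then (r.prob₁ : ℝ≥0∞) else 0)

/-- The series in `u` given by `A (n, u)`, where the first argument is instantiated with the Dirac
distribution at `n`: only the monomials whose first component is a multiset `k · [n]` contribute. -/
noncomputable def Series.atNum {Γ : Ctx} (A : Series (.nat :: Γ)) (n : ℕ) : Series Γ :=
  fun m => ∑' k : ℕ, A (Finsupp.sumElim (Finsupp.single n k) m)

/-- `∑ₙ A(u)ₙ · B(n, u)`. -/
noncomputable def Mor.letin {Γ : Ctx} {σ : Ty} (A : Mor Γ .nat) (B : Mor (.nat :: Γ) σ) :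
    Mor Γ σ :=
  fun b => Series.sum fun n : ℕ => A n * (B b).atNum n

/-- `A(u)₀ · B(u) + (∑ₙ A(u)ₙ₊₁) · D(u)`. -/
noncomputable def Mor.ifz {Γ : Ctx} {σ : Ty} (A : Mor Γ .nat) (B D : Mor Γ σ) : Mor Γ σ :=
  fun b => A (0 : ℕ) * B b + Series.sum (fun n : ℕ => A (n + 1 : ℕ)) * D b

/-- `A(u)(B(u))`, that is the family of the `∑_μ A(u)_(μ, b) · B(u)^μ`. -/
noncomputable def Mor.app {Γ : Ctx} {σ τ : Ty} (A : Mor Γ (.arr σ τ)) (B : Mor Γ σ) : Mor Γ τ :=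
  fun b => Series.sum fun μ : Web σ →₀ ℕ => A (μ, b) * μ.prod fun a k => B a ^ k

/-- Currying. -/
noncomputable def Mor.lam {Γ : Ctx} {σ τ : Ty} (A : Mor (σ :: Γ) τ) : Mor Γ (.arr σ τ) :=
  fun c m => A c.2 (Finsupp.sumElim c.1 m)

/-- The iterates `A(u)ⁿ(0)`. -/
noncomputable def Mor.iter {Γ : Ctx} {σ : Ty} (A : Mor Γ (.arr σ σ)) : ℕ → Mor Γ σ
  | 0 => 0
  | n + 1 => Mor.app A (Mor.iter A n)

/-- `supₙ A(u)ⁿ(0)`. -/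
noncomputable def Mor.fix {Γ : Ctx} {σ : Ty} (A : Mor Γ (.arr σ σ)) : Mor Γ σ :=
  fun b m => ⨆ n, Mor.iter A n b m

/-- The interpretation of terms. -/
noncomputable def sem : {Γ : Ctx} → {σ : Ty} → Tm Γ σ → Mor Γ σ
  | _, _, .num n => Mor.num n
  | _, _, .succ M => Mor.mapNat (fun n => n + 1) (sem M)
  | _, _, .pred M => Mor.mapNat (fun n => n - 1) (sem M)
  | _, _, .var x => fun a => MvPowerSeries.X (x.inWeb a)
  | _, _, .dice r => Mor.dice r
  | _, _, .letin M N => Mor.letin (sem M) (sem N)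
  | _, _, .ifz M N P => Mor.ifz (sem M) (sem N) (sem P)
  | _, _, .app M N => Mor.app (sem M) (sem N)
  | _, _, .lam M => Mor.lam (sem M)
  | _, _, .fix M => Mor.fix (sem M)

/-- The interpretation of a closed term, a vector indexed by the web of its type. -/
noncomputable def den {σ : Ty} (M : Closed σ) : Web σ → ℝ≥0∞ :=
  fun a => MvPowerSeries.constantCoeff (sem M a)

end PPCF

namespace PPCF

/-! ## Substitution calculus -/

/-! The proof combines adequacy of the semantics with an elementary convexity estimate.

Adequacy (`convProb_eq_den`): for closed `M` of ground type, the probability of reaching `0` is the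
coefficient at `0` of the denotation of `M`. Each inequality comes from a logical relation between
vectors and functionals on stacks: `lowerRel_subst` follows the Kleene iterates of a fixpoint, and
`upperRel_subst` counts machine steps. Both rest on a compositional reading of the semantics:
evaluating the series `sem M` at a point `u` in `[0,∞]` turns every constructor into an operation on
vectors, with application becoming `kleisli`. It follows (`convProb_tamed`) that the tamed context
built from `C`, applied to `M`, converges with probability `f(p·x)`, where `x = den M` and `f` is
the component at `0` of the function denoted by `C`. By `eval_sem_mem`, `f ≤ 1` on the space `P` of
the type.

Estimate: let `z = x ∧ y` and `x - z = r·w` with `w ∈ P`. Put `h = (1-p)·w` and `c = p·r/(1-p)`, so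
that `p·x = p·z + c·h`, while `p·z + h` lies in `P` by convexity. Since `f` has nonnegative
coefficients, it is convex along the ray from `p·z` in the direction `h`; if `c ≤ 1`, then `f(p·x) -
f(p·z) ≤ c·(f(p·z + h) - f(p·z)) ≤ c`. If `c ≥ 1` the bound is trivial. The infimum over `r` gives
`p/(1-p)·‖x - z‖`; the same holds for `y`, and monotonicity of `f` compares both values with the one
at `z`. -/

theorem Tm.subst_congr {Γ Δ : Ctx} {σ : Ty} (M : Tm Γ σ) {s s' : Sub Γ Δ}
    (h : ∀ τ (x : Var Γ τ), s x = s' x) : M.subst s = M.subst s' := by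
  have : s = s' := by funext τ x; exact h τ x
  rw [this]

/-- The order of the four fusion laws is forced by binders: commuting `lift` with a composition
requires the laws already proved. -/
theorem Tm.rename_rename {Γ : Ctx} {σ : Ty} (M : Tm Γ σ) : ∀ {Δ Θ : Ctx} (ρ : Ren Γ Δ)
    (ρ' : Ren Δ Θ), (M.rename ρ).rename ρ' = M.rename (fun _ x => ρ' (ρ x)) := by
  have key : ∀ {Γ Δ Θ : Ctx} (ρ : Ren Γ Δ) (ρ' : Ren Δ Θ) (τ : Ty),
      (fun _ x => ρ'.lift τ (ρ.lift τ x) : Ren (τ :: Γ) (τ :: Θ)) =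
        Ren.lift (fun _ x => ρ' (ρ x)) τ := by
    intros; funext υ x; cases x <;> rfl
  induction M with
  | num n => intros; rfl
  | dice r => intros; rfl
  | var x => intros; rfl
  | succ M ih => intros; simp only [Tm.rename, ih]
  | pred M ih => intros; simp only [Tm.rename, ih]
  | ifz M N P ih₁ ih₂ ih₃ => intros; simp only [Tm.rename, ih₁, ih₂, ih₃]
  | app M N ih₁ ih₂ => intros; simp only [Tm.rename, ih₁, ih₂]
  | fix M ih => intros; simp only [Tm.rename, ih]
  | letin M N ih₁ ih₂ => intros; simp only [Tm.rename, ih₁, ih₂]; rw [key]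
  | lam M ih => intros; simp only [Tm.rename, ih]; rw [key]

theorem Tm.subst_rename {Γ : Ctx} {σ : Ty} (M : Tm Γ σ) : ∀ {Δ Θ : Ctx} (ρ : Ren Γ Δ)
    (s : Sub Δ Θ), (M.rename ρ).subst s = M.subst (fun _ x => s (ρ x)) := by
  have key : ∀ {Γ Δ Θ : Ctx} (ρ : Ren Γ Δ) (s : Sub Δ Θ) (τ : Ty),
      (fun _ x => s.lift τ (ρ.lift τ x) : Sub (τ :: Γ) (τ :: Θ)) =
        Sub.lift (fun _ x => s (ρ x)) τ := by
    intros; funext υ x; cases x <;> rfl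
  induction M with
  | num n => intros; rfl
  | dice r => intros; rfl
  | var x => intros; rfl
  | succ M ih => intros; simp only [Tm.rename, Tm.subst, ih]
  | pred M ih => intros; simp only [Tm.rename, Tm.subst, ih]
  | ifz M N P ih₁ ih₂ ih₃ => intros; simp only [Tm.rename, Tm.subst, ih₁, ih₂, ih₃]
  | app M N ih₁ ih₂ => intros; simp only [Tm.rename, Tm.subst, ih₁, ih₂]
  | fix M ih => intros; simp only [Tm.rename, Tm.subst, ih]
  | letin M N ih₁ ih₂ => intros; simp only [Tm.rename, Tm.subst, ih₁, ih₂]; rw [key]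
  | lam M ih => intros; simp only [Tm.rename, Tm.subst, ih]; rw [key]

theorem Tm.rename_subst {Γ : Ctx} {σ : Ty} (M : Tm Γ σ) : ∀ {Δ Θ : Ctx} (s : Sub Γ Δ)
    (ρ : Ren Δ Θ), (M.subst s).rename ρ = M.subst (fun _ x => (s x).rename ρ) := by
  have key : ∀ {Γ Δ Θ : Ctx} (s : Sub Γ Δ) (ρ : Ren Δ Θ) (τ : Ty),
      (fun _ x => (s.lift τ x).rename (ρ.lift τ) : Sub (τ :: Γ) (τ :: Θ)) =
        Sub.lift (fun _ x => (s x).rename ρ) τ := by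
    intros
    funext υ x
    cases x with
    | zero => rfl
    | succ x => simp only [Sub.lift, Tm.weaken, Tm.rename_rename, Ren.lift]
  induction M with
  | num n => intros; rfl
  | dice r => intros; rfl
  | var x => intros; rfl
  | succ M ih => intros; simp only [Tm.rename, Tm.subst, ih]
  | pred M ih => intros; simp only [Tm.rename, Tm.subst, ih]
  | ifz M N P ih₁ ih₂ ih₃ => intros; simp only [Tm.rename, Tm.subst, ih₁, ih₂, ih₃]
  | app M N ih₁ ih₂ => intros; simp only [Tm.rename, Tm.subst, ih₁, ih₂]
  | fix M ih => intros; simp only [Tm.rename, Tm.subst, ih]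
  | letin M N ih₁ ih₂ => intros; simp only [Tm.rename, Tm.subst, ih₁, ih₂]; rw [key]
  | lam M ih => intros; simp only [Tm.rename, Tm.subst, ih]; rw [key]

theorem Tm.subst_subst {Γ : Ctx} {σ : Ty} (M : Tm Γ σ) : ∀ {Δ Θ : Ctx} (s : Sub Γ Δ)
    (t : Sub Δ Θ), (M.subst s).subst t = M.subst (fun _ x => (s x).subst t) := by
  have key : ∀ {Γ Δ Θ : Ctx} (s : Sub Γ Δ) (t : Sub Δ Θ) (τ : Ty),
      (fun _ x => (s.lift τ x).subst (t.lift τ) : Sub (τ :: Γ) (τ :: Θ)) =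
        Sub.lift (fun _ x => (s x).subst t) τ := by
    intros
    funext υ x
    cases x with
    | zero => rfl
    | succ x =>
      simp only [Sub.lift, Tm.weaken, Tm.subst_rename, Tm.rename_subst]
  induction M with
  | num n => intros; rfl
  | dice r => intros; rfl
  | var x => intros; rfl
  | succ M ih => intros; simp only [Tm.subst, ih]
  | pred M ih => intros; simp only [Tm.subst, ih]
  | ifz M N P ih₁ ih₂ ih₃ => intros; simp only [Tm.subst, ih₁, ih₂, ih₃]
  | app M N ih₁ ih₂ => intros; simp only [Tm.subst, ih₁, ih₂]
  | fix M ih => intros; simp only [Tm.subst, ih]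
  | letin M N ih₁ ih₂ => intros; simp only [Tm.subst, ih₁, ih₂]; rw [key]
  | lam M ih => intros; simp only [Tm.subst, ih]; rw [key]

theorem Tm.subst_var {Γ : Ctx} {σ : Ty} (M : Tm Γ σ) : M.subst (fun _ x => .var x) = M := by
  have key : ∀ (Γ : Ctx) (τ : Ty), Sub.lift (fun _ x => .var x : Sub Γ Γ) τ = fun _ x => .var x := by
    intros; funext υ x; cases x <;> rfl
  induction M with
  | num n => rfl
  | dice r => rfl
  | var x => rfl
  | succ M ih => simp only [Tm.subst, ih]
  | pred M ih => simp only [Tm.subst, ih]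
  | ifz M N P ih₁ ih₂ ih₃ => simp only [Tm.subst, ih₁, ih₂, ih₃]
  | app M N ih₁ ih₂ => simp only [Tm.subst, ih₁, ih₂]
  | fix M ih => simp only [Tm.subst, ih]
  | letin M N ih₁ ih₂ => rw [Tm.subst, key, ih₁, ih₂]
  | lam M ih => rw [Tm.subst, key, ih]

/-- Extension of a substitution by a term for the last variable. -/
def Sub.cons {Γ Δ : Ctx} {τ : Ty} (N : Tm Δ τ) (s : Sub Γ Δ) : Sub (τ :: Γ) Δ
  | _, .zero => N
  | _, .succ x => s x

/-- The β and `let` transitions act on bodies already closed by `s`; this identity recasts them as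
one closing substitution, matching an extended environment in the logical relations. -/
theorem Tm.subst_lift_inst {Γ Δ : Ctx} {σ τ : Ty} (M : Tm (τ :: Γ) σ) (s : Sub Γ Δ)
    (N : Tm Δ τ) : (M.subst (s.lift τ)).inst N = M.subst (Sub.cons N s) := by
  rw [Tm.inst, Tm.subst_subst]
  refine Tm.subst_congr _ fun υ x => ?_
  cases x with
  | zero => rfl
  | succ x =>
    simp only [Sub.lift, Tm.weaken, Tm.subst_rename, Sub.cons]
    exact Tm.subst_var _

theorem Tm.weaken_inst {Γ : Ctx} {σ τ : Ty} (M : Tm Γ σ) (N : Tm Γ τ) :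
    (M.weaken τ).inst N = M := by
  rw [Tm.inst, Tm.weaken, Tm.subst_rename]
  exact Tm.subst_var _

/-! ## Convergence probability as a supremum over the number of steps -/

/-- The probability that a state reaches success in fewer than `n` transitions. -/
noncomputable def State.runProb : ℕ → State → ℝ≥0∞
  | 0, _ => 0
  | n + 1, s =>
    match s.step with
    | .halt => 1
    | .stuck => 0
    | .next s' => runProb n s'
    | .toss r s₀ s₁ => runProb n s₀ * (r.prob₀ : ℝ≥0∞) + runProb n s₁ * (r.prob₁ : ℝ≥0∞)

theorem State.runProb_succ_le (n : ℕ) : ∀ s : State, s.runProb n ≤ s.runProb (n + 1) := by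
  induction n with
  | zero => intro s; exact zero_le
  | succ n ih =>
    intro s
    rw [runProb, runProb]
    cases s.step with
    | halt => exact le_rfl
    | stuck => exact le_rfl
    | next s' => exact ih s'
    | toss r s₀ s₁ =>
      dsimp only
      gcongr
      · exact ih s₀
      · exact ih s₁

theorem State.runProb_mono (s : State) : Monotone fun n => s.runProb n :=
  monotone_nat_of_le_succ fun n => runProb_succ_le n s

theorem tsum_evFuel (n : ℕ) : ∀ s : State, ∑' α, evFuel n s α = s.runProb n := by
  induction n with
  | zero => intro s; simp [evFuel, State.runProb]
  | succ n ih =>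
    intro s
    rw [State.runProb]
    cases h : s.step with
    | halt =>
      rw [tsum_eq_single []]
      · simp [evFuel, h]
      · rintro (_ | ⟨b, α⟩) hα
        · exact absurd rfl hα
        · simp [evFuel, h]
    | stuck =>
      have : ∀ α, evFuel (n + 1) s α = 0 := fun α => by simp [evFuel, h]
      simp [this]
    | next s' =>
      have : ∀ α, evFuel (n + 1) s α = evFuel n s' α := fun α => by simp [evFuel, h]
      simpa [this] using ih s'
    | toss r s₀ s₁ =>
      have hinj : Function.Injective fun q : Bool × List Bool => q.1 :: q.2 := by
        rintro ⟨a, α⟩ ⟨b, β⟩ hab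
        simpa using hab
      -- A toss consumes a bit, so the empty list contributes nothing and the sum splits by the
      -- first bit.
      rw [← hinj.tsum_eq, ENNReal.tsum_prod', tsum_bool]
      · have e₀ : ∀ α, evFuel (n + 1) s (false :: α) = evFuel n s₀ α * (r.prob₀ : ℝ≥0∞) :=
          fun α => by simp [evFuel, h]
        have e₁ : ∀ α, evFuel (n + 1) s (true :: α) = evFuel n s₁ α * (r.prob₁ : ℝ≥0∞) :=
          fun α => by simp [evFuel, h]
        simp only [e₀, e₁, ENNReal.tsum_mul_right, ih]
      · rintro (_ | ⟨b, α⟩) hα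
        · simp [evFuel, h] at hα
        · exact ⟨(b, α), rfl⟩

theorem evFuel_succ_le (n : ℕ) : ∀ s α, evFuel n s α ≤ evFuel (n + 1) s α := by
  induction n with
  | zero => intro s α; simp [evFuel]
  | succ n ih =>
    intro s α
    cases hs : s.step with
    | halt => cases α <;> simp [evFuel, hs]
    | stuck => simp [evFuel, hs]
    | next s' =>
      have e : ∀ n, evFuel (n + 1) s α = evFuel n s' α := fun n => by simp [evFuel, hs]
      rw [e, e]
      exact ih _ _
    | toss r s₀ s₁ =>
      rcases α with _ | ⟨_ | _, α⟩
      · simp [evFuel, hs]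
      · have e : ∀ n, evFuel (n + 1) s (false :: α) = evFuel n s₀ α * (r.prob₀ : ℝ≥0∞) :=
          fun n => by simp [evFuel, hs]
        rw [e, e]
        exact mul_le_mul_left (ih _ _) _
      · have e : ∀ n, evFuel (n + 1) s (true :: α) = evFuel n s₁ α * (r.prob₁ : ℝ≥0∞) :=
          fun n => by simp [evFuel, hs]
        rw [e, e]
        exact mul_le_mul_left (ih _ _) _

theorem Eval.of_evFuel_ne_zero (n : ℕ) : ∀ s α, evFuel n s α ≠ 0 → ∃ w, Eval s α w := by
  induction n with
  | zero => intro s α h; simp [evFuel] at h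
  | succ n ih =>
    intro s α h
    cases hs : s.step with
    | halt =>
      cases α with
      | nil => exact ⟨_, .halt hs⟩
      | cons b α => simp [evFuel, hs] at h
    | stuck => simp [evFuel, hs] at h
    | next s' =>
      have e : evFuel (n + 1) s α = evFuel n s' α := by simp [evFuel, hs]
      obtain ⟨w, hw⟩ := ih _ _ (e ▸ h)
      exact ⟨_, .next hs hw⟩
    | toss r s₀ s₁ =>
      rcases α with _ | ⟨_ | _, α⟩
      · simp [evFuel, hs] at h
      · have e : evFuel (n + 1) s (false :: α) = evFuel n s₀ α * (r.prob₀ : ℝ≥0∞) := by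
          simp [evFuel, hs]
        obtain ⟨w, hw⟩ := ih _ _ (left_ne_zero_of_mul (e ▸ h))
        exact ⟨_, .toss₀ hs hw⟩
      · have e : evFuel (n + 1) s (true :: α) = evFuel n s₁ α * (r.prob₁ : ℝ≥0∞) := by
          simp [evFuel, hs]
        obtain ⟨w, hw⟩ := ih _ _ (left_ne_zero_of_mul (e ▸ h))
        exact ⟨_, .toss₁ hs hw⟩

/-- Monotone convergence for sums. -/
theorem tsum_iSup_of_monotone {ι : Type} {f : ℕ → ι → ℝ≥0∞} (hf : ∀ i, Monotone fun n => f n i) :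
    ∑' i, ⨆ n, f n i = ⨆ n, ∑' i, f n i := by
  simp only [ENNReal.tsum_eq_iSup_sum]
  rw [iSup_comm]
  exact iSup_congr fun F => ENNReal.finsetSum_iSup_of_monotone hf

/-- For each bit list the fuelled weight increases and is eventually the true weight, so monotone
convergence exchanges the supremum with the sum over lists. -/
theorem State.convProb_eq_iSup (s : State) : s.convProb = ⨆ n, s.runProb n := by
  have mono : ∀ α, Monotone fun n => evFuel n s α :=
    fun α => monotone_nat_of_le_succ fun n => evFuel_succ_le n s α
  simp only [← tsum_evFuel]
  rw [← tsum_iSup_of_monotone mono, convProb]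
  have e : ∀ α : evDom s, (((ev s α.1).get α.2 : ℝ≥0) : ℝ≥0∞) = ⨆ n, evFuel n s α.1 := by
    intro α
    obtain ⟨N, hN⟩ := Eval.evFuel_eq (Exists.choose_spec α.2)
    refine le_antisymm ?_ (iSup_le fun n => ?_)
    · exact le_trans (hN N le_rfl).ge (le_iSup (fun n => evFuel n s α.1) N)
    · exact le_trans (mono α.1 (le_max_left n N)) (hN _ (le_max_right n N)).le
  rw [tsum_congr e]
  -- Lists outside `evDom s` have weight `0` for every amount of fuel, so summing over all lists
  -- changes nothing.
  refine tsum_subtype_eq_of_support_subset (f := fun α => ⨆ n, evFuel n s α) fun α hα => ?_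
  simp only [Function.mem_support, ne_eq, ENNReal.iSup_eq_zero, not_forall] at hα
  obtain ⟨n, hn⟩ := hα
  exact Eval.of_evFuel_ne_zero n s α hn

theorem State.runProb_le_convProb (n : ℕ) (s : State) : s.runProb n ≤ s.convProb := by
  rw [convProb_eq_iSup]; exact le_iSup (fun n => s.runProb n) n

theorem State.convProb_eq_iSup_succ (s : State) : s.convProb = ⨆ n, s.runProb (n + 1) := by
  rw [convProb_eq_iSup]
  exact (s.runProb_mono.iSup_nat_add 1).symm

theorem State.runProb_of_next {s s' : State} (h : s.step = .next s') (n : ℕ) :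
    s.runProb (n + 1) = s'.runProb n := by
  rw [runProb, h]

theorem State.runProb_le_of_next {s s' : State} (h : s.step = .next s') (n : ℕ) :
    s.runProb n ≤ s'.runProb n :=
  (runProb_succ_le n s).trans (runProb_of_next h n).le

theorem State.runProb_of_toss {s s₀ s₁ : State} {r : Coin} (h : s.step = .toss r s₀ s₁) (n : ℕ) :
    s.runProb (n + 1) =
      s₀.runProb n * (r.prob₀ : ℝ≥0∞) + s₁.runProb n * (r.prob₁ : ℝ≥0∞) := by
  rw [runProb, h]

theorem State.convProb_of_next {s s' : State} (h : s.step = .next s') :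
    s.convProb = s'.convProb := by
  rw [convProb_eq_iSup_succ, convProb_eq_iSup s']
  exact iSup_congr fun n => runProb_of_next h n

theorem State.convProb_of_toss {s s₀ s₁ : State} {r : Coin} (h : s.step = .toss r s₀ s₁) :
    s.convProb = s₀.convProb * (r.prob₀ : ℝ≥0∞) + s₁.convProb * (r.prob₁ : ℝ≥0∞) := by
  rw [convProb_eq_iSup_succ, convProb_eq_iSup s₀, convProb_eq_iSup s₁, ENNReal.iSup_mul,
    ENNReal.iSup_mul, ENNReal.iSup_add_iSup_of_monotone]
  · exact iSup_congr fun n => runProb_of_toss h n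
  · exact fun m n hmn => mul_le_mul_left (s₀.runProb_mono hmn) _
  · exact fun m n hmn => mul_le_mul_left (s₁.runProb_mono hmn) _

/-! ## Evaluation of power series -/

theorem promotion_zero {I : Type} (u : I → ℝ≥0∞) : promotion u 0 = 1 := Finsupp.prod_zero_index

theorem promotion_add {I : Type} (u : I → ℝ≥0∞) (m n : I →₀ ℕ) :
    promotion u (m + n) = promotion u m * promotion u n := by
  classical
  exact Finsupp.prod_add_index' (fun _ => pow_zero _) fun _ _ _ => pow_add _ _ _

theorem promotion_single {I : Type} (u : I → ℝ≥0∞) (a : I) (k : ℕ) :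
    promotion u (Finsupp.single a k) = u a ^ k :=
  Finsupp.prod_single_index (pow_zero _)

theorem promotion_sumElim {I J : Type} (x : I → ℝ≥0∞) (u : J → ℝ≥0∞) (μ : I →₀ ℕ) (m : J →₀ ℕ) :
    promotion (Sum.elim x u) (Finsupp.sumElim μ m) = promotion x μ * promotion u m := by
  rw [promotion, Finsupp.prod_sumElim]
  rfl

theorem promotion_mono {I : Type} {x y : I → ℝ≥0∞} (h : x ≤ y) : promotion x ≤ promotion y :=
  fun _ => Finset.prod_le_prod' fun a _ => pow_le_pow_left' (h a) _

theorem iSup_mul_iSup_of_monotone {f g : ℕ → ℝ≥0∞} (hf : Monotone f) (hg : Monotone g) :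
    (⨆ n, f n) * ⨆ n, g n = ⨆ n, f n * g n := by
  refine le_antisymm ?_ (iSup_le fun n => mul_le_mul' (le_iSup f n) (le_iSup g n))
  simp only [ENNReal.iSup_mul, ENNReal.mul_iSup]
  refine iSup_le fun i => iSup_le fun j => le_iSup_of_le (max i j) ?_
  exact mul_le_mul' (hf (by simp)) (hg (by simp))

theorem promotion_iSup {I : Type} {x : ℕ → I → ℝ≥0∞} (h : Monotone x) (μ : I →₀ ℕ) :
    promotion (⨆ n, x n) μ = ⨆ n, promotion (x n) μ := by
  classical
  induction μ using Finsupp.induction with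
  | zero => simp [promotion_zero]
  | single_add a k μ _ _ ih =>
    simp only [promotion_add, promotion_single, ih, iSup_apply, ENNReal.iSup_pow]
    exact iSup_mul_iSup_of_monotone (fun m n hmn => pow_le_pow_left' (h hmn a) k)
      fun m n hmn => promotion_mono (h hmn) μ

/-- The value of a power series at a point. -/
noncomputable def Series.eval {Γ : Ctx} (u : CtxWeb Γ → ℝ≥0∞) (A : Series Γ) : ℝ≥0∞ :=
  ∑' m, A m * promotion u m

namespace Series

variable {Γ : Ctx} (u : CtxWeb Γ → ℝ≥0∞)

theorem eval_add (A B : Series Γ) : eval u (A + B) = eval u A + eval u B := by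
  simp only [eval]
  rw [← ENNReal.tsum_add]
  refine tsum_congr fun m => ?_
  rw [← add_mul]
  rfl

theorem eval_zero : eval u (0 : Series Γ) = 0 := by
  refine ENNReal.tsum_eq_zero.2 fun m => ?_
  exact zero_mul _

theorem eval_sum {ι : Type} (f : ι → Series Γ) : eval u (Series.sum f) = ∑' i, eval u (f i) := by
  simp only [eval, Series.sum, ← ENNReal.tsum_mul_right]
  exact ENNReal.tsum_comm

/-- The Cauchy product: in `[0,∞]` all rearrangements are allowed, so no convergence condition is
needed. -/
theorem eval_mul (A B : Series Γ) : eval u (A * B) = eval u A * eval u B := by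
  classical
  have h : ∀ m, (A * B) m = ∑ q ∈ Finset.HasAntidiagonal.antidiagonal m, A q.1 * B q.2 :=
    fun m => MvPowerSeries.coeff_mul m A B
  calc eval u (A * B)
      = ∑' m, ∑' q : Finset.HasAntidiagonal.antidiagonal m,
          (A q.1.1 * promotion u q.1.1) * (B q.1.2 * promotion u q.1.2) := by
        refine tsum_congr fun m => ?_
        rw [h, Finset.sum_mul, tsum_fintype, Finset.sum_coe_sort (Finset.HasAntidiagonal.antidiagonal m)
          (fun q => (A q.1 * promotion u q.1) * (B q.2 * promotion u q.2))]
        refine Finset.sum_congr rfl fun q hq => ?_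
        rw [← Finset.HasAntidiagonal.mem_antidiagonal.1 hq, promotion_add]
        ring
    _ = ∑' q : (CtxWeb Γ →₀ ℕ) × (CtxWeb Γ →₀ ℕ),
          (A q.1 * promotion u q.1) * (B q.2 * promotion u q.2) := by
        refine (ENNReal.tsum_sigma
          fun (m : CtxWeb Γ →₀ ℕ) (q : Finset.HasAntidiagonal.antidiagonal m) =>
            (A q.1.1 * promotion u q.1.1) * (B q.1.2 * promotion u q.1.2)).symm.trans ?_
        exact Finset.HasAntidiagonal.sigmaAntidiagonalEquivProd.tsum_eq
          (fun q => (A q.1 * promotion u q.1) * (B q.2 * promotion u q.2))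
    _ = eval u A * eval u B := by
        rw [ENNReal.tsum_prod']
        simp only [ENNReal.tsum_mul_left, ENNReal.tsum_mul_right]
        rfl

theorem eval_monomial [DecidableEq (CtxWeb Γ)] (A : Series Γ) (n : CtxWeb Γ →₀ ℕ) (c : ℝ≥0∞)
    (h : ∀ m, A m = if m = n then c else 0) : eval u A = c * promotion u n := by
  rw [eval, tsum_eq_single n]
  · rw [h, if_pos rfl]
  · intro m hm
    rw [h, if_neg hm, zero_mul]

theorem eval_C (c : ℝ≥0∞) : eval u (MvPowerSeries.C c : Series Γ) = c := by
  classical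
  rw [eval_monomial u (MvPowerSeries.C c) 0 c fun m => MvPowerSeries.coeff_C m c, promotion_zero, mul_one]

theorem eval_one : eval u (1 : Series Γ) = 1 := by
  classical
  rw [eval_monomial u 1 0 1 fun m => MvPowerSeries.coeff_one m, promotion_zero, mul_one]

theorem eval_X (a : CtxWeb Γ) : eval u (MvPowerSeries.X a : Series Γ) = u a := by
  classical
  rw [eval_monomial u (MvPowerSeries.X a) (Finsupp.single a 1) 1 fun m => MvPowerSeries.coeff_X m a,
    promotion_single, pow_one, one_mul]

/-- Evaluation as a multiplicative map. -/
noncomputable def evalHom : Series Γ →* ℝ≥0∞ where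
  toFun := eval u
  map_one' := eval_one u
  map_mul' := eval_mul u

theorem eval_prod_pow {I : Type} (B : I → Series Γ) (μ : I →₀ ℕ) :
    eval u (μ.prod fun a k => B a ^ k) = promotion (fun a => eval u (B a)) μ := by
  have h := map_prod (evalHom u) (fun a => B a ^ μ a) μ.support
  simp only [map_pow] at h
  exact h

/-- At a Dirac vector every monomial vanishes except the powers of the variable `n`, which equal
`1`; these are the ones kept by `atNum`. -/
theorem eval_atNum (A : Series (.nat :: Γ)) (n : ℕ) :
    eval u (A.atNum n) = eval (Γ := .nat :: Γ) (Sum.elim (fun k : ℕ => if k = n then 1 else 0) u) A := by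
  classical
  have hinj : Function.Injective fun k : ℕ => Finsupp.single n k := Finsupp.single_injective n
  rw [eval, eval, ← Finsupp.sumFinsuppEquivProdFinsupp.symm.tsum_eq, ENNReal.tsum_prod',
    ENNReal.tsum_comm]
  refine tsum_congr fun m => ?_
  rw [← hinj.tsum_eq, Series.atNum, ← ENNReal.tsum_mul_right]
  · refine tsum_congr fun k => ?_
    change _ = A (Finsupp.sumElim (Finsupp.single n k) m) *
      promotion (Sum.elim (fun k : ℕ => if k = n then 1 else 0) u)
        (Finsupp.sumElim (Finsupp.single n k) m)
    rw [promotion_sumElim, promotion_single, if_pos rfl, one_pow, one_mul]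
  · intro μ hμ
    refine ⟨μ n, ?_⟩
    by_contra hne
    refine hμ ?_
    change A (Finsupp.sumElim μ m) *
      promotion (Sum.elim (fun k : ℕ => if k = n then 1 else 0) u) (Finsupp.sumElim μ m) = 0
    -- A multiset that is not a multiple of `[n]` contains some `k ≠ n`, and that factor is zero.
    obtain ⟨k, hk, hkn⟩ : ∃ k, μ k ≠ 0 ∧ k ≠ n := by
      by_contra! hcon
      refine hne (Finsupp.ext fun k => ?_)
      by_cases hk : k = n
      · simp [hk]
      · have : μ k = 0 := by by_contra h0; exact hk (hcon k h0)
        simp [this, Ne.symm hk]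
    have : promotion (fun k : ℕ => if k = n then (1 : ℝ≥0∞) else 0) μ = 0 :=
      Finset.prod_eq_zero (Finsupp.mem_support_iff.2 hk) (by simp [hkn, hk])
    rw [promotion_sumElim, this, zero_mul, mul_zero]

end Series

/-! ### Kleisli application: monotonicity, continuity and fixed points. -/

/-- The function induced by a matrix of `!⟦σ⟧ ⊸ ⟦τ⟧`. -/
noncomputable def kleisli {I J : Type} (t : (I →₀ ℕ) × J → ℝ≥0∞) (x : I → ℝ≥0∞) : J → ℝ≥0∞ :=
  matApp t (promotion x)

theorem matApp_iSup_left {I J : Type} {t : ℕ → I × J → ℝ≥0∞} (h : Monotone t) (v : I → ℝ≥0∞) :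
    matApp (⨆ n, t n) v = ⨆ n, matApp (t n) v := by
  funext j
  simp only [matApp, iSup_apply, ENNReal.iSup_mul]
  exact tsum_iSup_of_monotone fun i m n hmn => mul_le_mul_left (h hmn _) _

theorem matApp_mono_left {I J : Type} {s t : I × J → ℝ≥0∞} (h : s ≤ t) (v : I → ℝ≥0∞) :
    matApp s v ≤ matApp t v :=
  fun _ => ENNReal.tsum_le_tsum fun _ => mul_le_mul_left (h _) _

theorem kleisli_mono {I J : Type} (t : (I →₀ ℕ) × J → ℝ≥0∞) {x y : I → ℝ≥0∞} (h : x ≤ y) :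
    kleisli t x ≤ kleisli t y :=
  fun _ => ENNReal.tsum_le_tsum fun μ => mul_le_mul_right (promotion_mono h μ) _

theorem kleisli_iSup {I J : Type} (t : (I →₀ ℕ) × J → ℝ≥0∞) {x : ℕ → I → ℝ≥0∞} (h : Monotone x) :
    kleisli t (⨆ n, x n) = ⨆ n, kleisli t (x n) := by
  funext j
  simp only [kleisli, matApp, iSup_apply, promotion_iSup h, ENNReal.mul_iSup]
  exact tsum_iSup_of_monotone fun μ m n hmn => mul_le_mul_right (promotion_mono (h hmn) μ) _

/-- The iterates of a matrix from `0`. -/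
noncomputable def kleisliIter {I : Type} (t : (I →₀ ℕ) × I → ℝ≥0∞) : ℕ → I → ℝ≥0∞
  | 0 => 0
  | n + 1 => kleisli t (kleisliIter t n)

theorem kleisliIter_mono {I : Type} (t : (I →₀ ℕ) × I → ℝ≥0∞) : Monotone (kleisliIter t) := by
  refine monotone_nat_of_le_succ fun n => ?_
  induction n with
  | zero => exact fun _ => zero_le
  | succ n ih => exact kleisli_mono t ih

/-- Kleene's argument: continuity turns the supremum of the iterates into a fixed point, for any
matrix over `[0,∞]`. -/
theorem kleisli_iSup_iter {I : Type} (t : (I →₀ ℕ) × I → ℝ≥0∞) :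
    kleisli t (⨆ n, kleisliIter t n) = ⨆ n, kleisliIter t n := by
  rw [kleisli_iSup t (kleisliIter_mono t)]
  exact (kleisliIter_mono t).iSup_nat_add 1

/-! ### Pointwise values of the semantic constructors. -/

/-- The value of a Kleisli morphism at a point. -/
noncomputable def Mor.eval {Γ : Ctx} {σ : Ty} (u : CtxWeb Γ → ℝ≥0∞) (A : Mor Γ σ) : Web σ → ℝ≥0∞ :=
  fun a => Series.eval u (A a)

/-- The `n`-th Dirac vector. -/
noncomputable def dirac (n : ℕ) : ℕ → ℝ≥0∞ := fun k => if k = n then 1 else 0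

/-- The environment extended by a value for the last variable. -/
def envCons {Γ : Ctx} {σ : Ty} (x : Web σ → ℝ≥0∞) (u : CtxWeb Γ → ℝ≥0∞) :
    CtxWeb (σ :: Γ) → ℝ≥0∞ :=
  Sum.elim x u

namespace Mor

variable {Γ : Ctx} {σ τ : Ty} (u : CtxWeb Γ → ℝ≥0∞)

theorem eval_num (n : ℕ) : eval u (Mor.num n) = dirac n := by
  funext k
  simp only [eval, Mor.num, dirac]
  split_ifs
  · exact Series.eval_one u
  · exact Series.eval_zero u

theorem eval_dice (r : Coin) (k : ℕ) : eval u (Mor.dice r) k =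
    if k = 0 then (r.prob₀ : ℝ≥0∞) else if k = 1 then (r.prob₁ : ℝ≥0∞) else 0 :=
  Series.eval_C u _

theorem eval_mapNat (f : ℕ → ℕ) (A : Mor Γ .nat) (k : ℕ) :
    eval u (Mor.mapNat f A) k = ∑' n : ℕ, if f n = k then eval u A n else 0 := by
  rw [eval, Mor.mapNat, Series.eval_sum]
  refine tsum_congr fun n => ?_
  split_ifs
  · rfl
  · exact Series.eval_zero u

theorem eval_letin (A : Mor Γ .nat) (B : Mor (.nat :: Γ) σ) (b : Web σ) :
    eval u (Mor.letin A B) b = ∑' n : ℕ, eval u A n * eval (envCons (dirac n) u) B b := by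
  rw [eval, Mor.letin, Series.eval_sum]
  refine tsum_congr fun n => ?_
  rw [Series.eval_mul, Series.eval_atNum]
  rfl

/-- Written as a mixture indexed by the value of the test, the conditional is handled like `let`, by
closure under weighted sums. -/
theorem eval_ifz (A : Mor Γ .nat) (B D : Mor Γ σ) (b : Web σ) :
    eval u (Mor.ifz A B D) b =
      ∑' n : ℕ, eval u A n * (if n = 0 then eval u B b else eval u D b) := by
  rw [eval, Mor.ifz, Series.eval_add, Series.eval_mul, Series.eval_mul, Series.eval_sum,
    ← ENNReal.tsum_mul_right]
  conv_rhs => rw [tsum_eq_zero_add' ENNReal.summable]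
  simp [eval]

theorem eval_app (A : Mor Γ (.arr σ τ)) (B : Mor Γ σ) :
    eval u (Mor.app A B) = kleisli (eval u A) (eval u B) := by
  funext b
  rw [eval, Mor.app, Series.eval_sum]
  refine tsum_congr fun μ => ?_
  rw [Series.eval_mul, Series.eval_prod_pow]
  rfl

theorem kleisli_eval_lam (A : Mor (σ :: Γ) τ) (x : Web σ → ℝ≥0∞) :
    kleisli (eval u (Mor.lam A)) x = eval (envCons x u) A := by
  funext b
  rw [eval, Series.eval, ← Finsupp.sumFinsuppEquivProdFinsupp.symm.tsum_eq, ENNReal.tsum_prod']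
  refine tsum_congr fun μ => ?_
  rw [eval, Series.eval, ← ENNReal.tsum_mul_right]
  refine tsum_congr fun m => ?_
  change _ = A b (Finsupp.sumElim μ m) * promotion (Sum.elim x u) (Finsupp.sumElim μ m)
  rw [promotion_sumElim, Mor.lam, mul_assoc, mul_comm (promotion u m)]

end Mor

/-! ### Monotonicity of coefficients and evaluation of fixpoints. -/

namespace Series

variable {Γ : Ctx}

theorem mul_coeff_mono {A A' B B' : Series Γ} (hA : ∀ m, A m ≤ A' m) (hB : ∀ m, B m ≤ B' m)
    (m : CtxWeb Γ →₀ ℕ) : (A * B) m ≤ (A' * B') m := by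
  classical
  have h : ∀ A B : Series Γ, (A * B) m = ∑ q ∈ Finset.HasAntidiagonal.antidiagonal m, A q.1 * B q.2 :=
    fun A B => MvPowerSeries.coeff_mul m A B
  rw [h, h]
  exact Finset.sum_le_sum fun q _ => mul_le_mul' (hA _) (hB _)

theorem pow_coeff_mono {A A' : Series Γ} (hA : ∀ m, A m ≤ A' m) (k : ℕ) :
    ∀ m, (A ^ k) m ≤ (A' ^ k) m := by
  induction k with
  | zero => intro m; rw [pow_zero, pow_zero]
  | succ k ih => rw [pow_succ, pow_succ]; exact mul_coeff_mono ih hA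

theorem prod_coeff_mono {I : Type} {A A' : I → Series Γ} (F : Finset I)
    (h : ∀ i m, A i m ≤ A' i m) : ∀ m, (∏ i ∈ F, A i) m ≤ (∏ i ∈ F, A' i) m := by
  classical
  induction F using Finset.induction_on with
  | empty => intro m; simp
  | insert i F hi ih =>
    rw [Finset.prod_insert hi, Finset.prod_insert hi]
    exact mul_coeff_mono (h i) ih

end Series

namespace Mor

variable {Γ : Ctx} {σ : Ty}

/-- `Mor.fix` takes suprema coefficient by coefficient; monotonicity is what lets evaluation commute
with them in `eval_fix`. -/
theorem iter_coeff_mono (A : Mor Γ (.arr σ σ)) (b : Web σ) (m : CtxWeb Γ →₀ ℕ) :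
    Monotone fun n => Mor.iter A n b m := by
  refine monotone_nat_of_le_succ fun n => ?_
  induction n generalizing b m with
  | zero => exact zero_le
  | succ n ih =>
    refine ENNReal.tsum_le_tsum fun μ => Series.mul_coeff_mono (fun _ => le_rfl) ?_ m
    exact Series.prod_coeff_mono _ fun a => Series.pow_coeff_mono (ih a) _

theorem eval_iter (u : CtxWeb Γ → ℝ≥0∞) (A : Mor Γ (.arr σ σ)) (n : ℕ) :
    eval u (Mor.iter A n) = kleisliIter (eval u A) n := by
  induction n with
  | zero => funext b; exact Series.eval_zero u
  | succ n ih => rw [Mor.iter, eval_app, ih, kleisliIter]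

theorem eval_fix (u : CtxWeb Γ → ℝ≥0∞) (A : Mor Γ (.arr σ σ)) :
    eval u (Mor.fix A) = ⨆ n, kleisliIter (eval u A) n := by
  funext b
  simp only [iSup_apply, ← eval_iter]
  rw [eval, Series.eval]
  simp only [Mor.fix, ENNReal.iSup_mul]
  exact tsum_iSup_of_monotone fun m i j hij => mul_le_mul_left (iter_coeff_mono A b m hij) _

end Mor

/-- Over the empty web there is only one monomial, so evaluation at any point returns the constant
coefficient. -/
theorem den_eq_eval {σ : Ty} (M : Closed σ) (u : CtxWeb [] → ℝ≥0∞) : den M = Mor.eval u (sem M) := by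
  funext a
  have : Unique (CtxWeb [] →₀ ℕ) := ⟨⟨0⟩, fun m => Finsupp.ext fun i => i.elim⟩
  rw [Mor.eval, Series.eval, tsum_eq_single 0 fun m hm => absurd (Subsingleton.elim m 0) hm,
    promotion_zero, mul_one]
  exact (MvPowerSeries.coeff_zero_eq_constantCoeff_apply _).symm

/-! ## Logical relations -/

theorem matApp_tsum_left {ι I J : Type} (a : ι → ℝ≥0∞) (t : ι → I × J → ℝ≥0∞) (v : I → ℝ≥0∞) :
    matApp (fun q => ∑' i, a i * t i q) v = fun j => ∑' i, a i * matApp (t i) v j := by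
  funext j
  simp only [matApp, ← ENNReal.tsum_mul_left, ← ENNReal.tsum_mul_right]
  rw [ENNReal.tsum_comm]
  simp only [mul_assoc]

theorem matApp_zero_left {I J : Type} (v : I → ℝ≥0∞) : matApp (0 : I × J → ℝ≥0∞) v = 0 := by
  funext j
  simp [matApp]

/-- `LowerRel σ φ x`: the convergence probabilities `φ` of a program, as a function of the stack,
are at least what is predicted by its denotation `x`. -/
def LowerRel : (σ : Ty) → (Stack σ → ℝ≥0∞) → (Web σ → ℝ≥0∞) → Prop
  | .nat, φ, x => ∀ π, ∑' j : ℕ, x j * State.convProb ⟨.nat, .num j, π⟩ ≤ φ π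
  | .arr σ τ, φ, f => ∀ (N : Closed σ) (x : Web σ → ℝ≥0∞),
      LowerRel σ (fun π => State.convProb ⟨σ, N, π⟩) x →
        LowerRel τ (fun π => φ (.arg N π)) (kleisli f x)

/-- Relating functionals on stacks, rather than terms, lets a machine transition act as a mere
inequality or equality of functionals. -/
theorem LowerRel.mono : ∀ {σ : Ty} {φ ψ : Stack σ → ℝ≥0∞} {x : Web σ → ℝ≥0∞},
    (∀ π, φ π ≤ ψ π) → LowerRel σ φ x → LowerRel σ ψ x
  | .nat, _, _, _, h, H => fun π => (H π).trans (h π)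
  | .arr _ _, _, _, _, h, H => fun N y hy => (H N y hy).mono fun π => h (.arg N π)

theorem LowerRel.zero : ∀ {σ : Ty} (φ : Stack σ → ℝ≥0∞), LowerRel σ φ 0
  | .nat, φ => fun π => by simp
  | .arr σ τ, φ => fun N y _ => by
    rw [kleisli, matApp_zero_left]
    exact LowerRel.zero _

/-- Application is linear in the function, so mixtures pass through arrow types. This serves the
branches of `if` and `let`. -/
theorem LowerRel.tsum {ι : Type} (a : ι → ℝ≥0∞) : ∀ {σ : Ty} {φ : ι → Stack σ → ℝ≥0∞}
    {x : ι → Web σ → ℝ≥0∞}, (∀ i, LowerRel σ (φ i) (x i)) →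
      LowerRel σ (fun π => ∑' i, a i * φ i π) (fun b => ∑' i, a i * x i b)
  | .nat, φ, x, h => fun π => by
    simp only [← ENNReal.tsum_mul_right]
    rw [ENNReal.tsum_comm]
    simp only [mul_assoc, ENNReal.tsum_mul_left]
    exact ENNReal.tsum_le_tsum fun i => mul_le_mul_right (h i π) _
  | .arr σ τ, φ, x, h => fun N y hy => by
    rw [kleisli, matApp_tsum_left]
    exact LowerRel.tsum a fun i => h i N y hy

/-- Admissibility: the functional stays fixed while its predicted lower bound increases. This is
what the fixpoint case needs. -/
theorem LowerRel.iSup : ∀ {σ : Ty} {φ : Stack σ → ℝ≥0∞} {x : ℕ → Web σ → ℝ≥0∞},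
    Monotone x → (∀ n, LowerRel σ φ (x n)) → LowerRel σ φ (⨆ n, x n)
  | .nat, φ, x, hx, h => fun π => by
    simp only [iSup_apply, ENNReal.iSup_mul]
    refine (tsum_iSup_of_monotone
      (f := fun n (j : ℕ) => x n j * State.convProb ⟨.nat, .num j, π⟩)
      fun j m n hmn => mul_le_mul_left (hx hmn j) _).le.trans ?_
    exact iSup_le fun n => h n π
  | .arr σ τ, φ, x, hx, h => fun N y hy => by
    rw [kleisli, matApp_iSup_left hx]
    exact LowerRel.iSup (fun m n hmn => matApp_mono_left (hx hmn) _) fun n => h n N y hy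

/-- `UpperRel σ n Φ x`: the probabilities `Φ k` of convergence in `k ≤ n` steps, as a function of
the stack, are at most what is predicted by the denotation `x`. -/
def UpperRel : (σ : Ty) → ℕ → (ℕ → Stack σ → ℝ≥0∞) → (Web σ → ℝ≥0∞) → Prop
  | .nat, n, Φ, x => ∀ k ≤ n, ∀ π, Φ k π ≤ ∑' j : ℕ, x j * State.runProb k ⟨.nat, .num j, π⟩
  | .arr σ τ, n, Φ, f => ∀ k ≤ n, ∀ (N : Closed σ) (x : Web σ → ℝ≥0∞),
      UpperRel σ k (fun i π => State.runProb i ⟨σ, N, π⟩) x →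
        UpperRel τ k (fun i π => Φ i (.arg N π)) (kleisli f x)

theorem UpperRel.of_le : ∀ {σ : Ty} {m n : ℕ} {Φ : ℕ → Stack σ → ℝ≥0∞} {x : Web σ → ℝ≥0∞},
    m ≤ n → UpperRel σ n Φ x → UpperRel σ m Φ x
  | .nat, _, _, _, _, h, H => fun k hk => H k (hk.trans h)
  | .arr _ _, _, _, _, _, h, H => fun k hk => H k (hk.trans h)

theorem UpperRel.anti : ∀ {σ : Ty} {n : ℕ} {Φ Ψ : ℕ → Stack σ → ℝ≥0∞} {x : Web σ → ℝ≥0∞},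
    (∀ k ≤ n, ∀ π, Φ k π ≤ Ψ k π) → UpperRel σ n Ψ x → UpperRel σ n Φ x
  | .nat, _, _, _, _, h, H => fun k hk π => (h k hk π).trans (H k hk π)
  | .arr _ _, _, _, _, _, h, H =>
    fun k hk N y hy => (H k hk N y hy).anti fun i hi π => h i (hi.trans hk) (.arg N π)

/-- Nothing succeeds within zero steps, so any prediction is an upper bound; this starts the
induction for fixpoints. -/
theorem UpperRel.zero : ∀ {σ : Ty} {Φ : ℕ → Stack σ → ℝ≥0∞} (x : Web σ → ℝ≥0∞),
    (∀ π, Φ 0 π = 0) → UpperRel σ 0 Φ x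
  | .nat, _, _, h => fun k hk π => by
    obtain rfl := Nat.le_zero.1 hk
    rw [h]
    exact zero_le
  | .arr σ τ, _, _, h => fun k hk N y _ => by
    obtain rfl := Nat.le_zero.1 hk
    exact UpperRel.zero _ fun π => h _

/-- A transition spent by the machine buys one unit of the index. Other constructors discard the
step they spend; only unfolding `fix` uses it. -/
theorem UpperRel.succ : ∀ {σ : Ty} {n : ℕ} {Φ Ψ : ℕ → Stack σ → ℝ≥0∞} {x : Web σ → ℝ≥0∞},
    (∀ π, Φ 0 π = 0) → (∀ k π, Φ (k + 1) π ≤ Ψ k π) → UpperRel σ n Ψ x → UpperRel σ (n + 1) Φ x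
  | .nat, n, Φ, Ψ, x, h₀, h, H => fun k hk π => by
    cases k with
    | zero => rw [h₀]; exact zero_le
    | succ k =>
      refine (h k π).trans ((H k (by omega) π).trans ?_)
      exact ENNReal.tsum_le_tsum fun j => mul_le_mul_right (State.runProb_succ_le k _) _
  | .arr σ τ, n, Φ, Ψ, x, h₀, h, H => fun k hk N y hy => by
    cases k with
    | zero => exact UpperRel.zero _ fun π => h₀ _
    | succ k =>
      exact UpperRel.succ (fun π => h₀ _) (fun i π => h i (.arg N π))
        (H k (by omega) N y (hy.of_le (Nat.le_succ k)))

theorem UpperRel.tsum {ι : Type} (a : ι → ℝ≥0∞) : ∀ {σ : Ty} {n : ℕ} {Φ : ι → ℕ → Stack σ → ℝ≥0∞}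
    {x : ι → Web σ → ℝ≥0∞}, (∀ i, UpperRel σ n (Φ i) (x i)) →
      UpperRel σ n (fun k π => ∑' i, a i * Φ i k π) (fun b => ∑' i, a i * x i b)
  | .nat, n, Φ, x, h => fun k hk π => by
    simp only [← ENNReal.tsum_mul_right]
    rw [ENNReal.tsum_comm]
    simp only [mul_assoc, ENNReal.tsum_mul_left]
    exact ENNReal.tsum_le_tsum fun i => mul_le_mul_right (h i k hk π) _
  | .arr σ τ, n, Φ, x, h => fun k hk N y hy => by
    rw [kleisli, matApp_tsum_left]
    exact UpperRel.tsum a fun i => h i k hk N y hy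

theorem tsum_dirac_mul (n : ℕ) (f : ℕ → ℝ≥0∞) : ∑' j, dirac n j * f j = f n := by
  rw [tsum_eq_single n]
  · simp [dirac]
  · intro j hj
    simp [dirac, hj]

theorem tsum_dice_mul (r : Coin) (f : ℕ → ℝ≥0∞) :
    ∑' k : ℕ, (if k = 0 then (r.prob₀ : ℝ≥0∞) else if k = 1 then (r.prob₁ : ℝ≥0∞) else 0) * f k =
      f 0 * (r.prob₀ : ℝ≥0∞) + f 1 * (r.prob₁ : ℝ≥0∞) := by
  rw [tsum_eq_zero_add' ENNReal.summable, tsum_eq_single 0]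
  · simp [mul_comm]
  · intro k hk
    simp [hk]

theorem tsum_mapNat_mul (f : ℕ → ℕ) (x g : ℕ → ℝ≥0∞) :
    ∑' k : ℕ, (∑' n : ℕ, if f n = k then x n else 0) * g k = ∑' n : ℕ, x n * g (f n) := by
  simp only [← ENNReal.tsum_mul_right]
  rw [ENNReal.tsum_comm]
  refine tsum_congr fun n => ?_
  rw [tsum_eq_single (f n)]
  · rw [if_pos rfl]
  · intro k hk
    rw [if_neg (Ne.symm hk), zero_mul]

/-- The value of a variable in an environment. -/
def Var.get {Γ : Ctx} {σ : Ty} (x : Var Γ σ) (u : CtxWeb Γ → ℝ≥0∞) : Web σ → ℝ≥0∞ :=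
  fun a => u (x.inWeb a)

theorem Mor.eval_var {Γ : Ctx} {σ : Ty} (u : CtxWeb Γ → ℝ≥0∞) (x : Var Γ σ) :
    Mor.eval u (fun a => MvPowerSeries.X (x.inWeb a)) = x.get u :=
  funext fun _ => Series.eval_X u _

/-! ### Fundamental lemmas of the two logical relations. -/

theorem lowerRel_num (n : ℕ) :
    LowerRel .nat (fun π => State.convProb ⟨.nat, .num n, π⟩) (dirac n) :=
  fun π => (tsum_dirac_mul n fun j => State.convProb ⟨.nat, .num j, π⟩).le

theorem upperRel_num (m n : ℕ) :
    UpperRel .nat m (fun k π => State.runProb k ⟨.nat, .num n, π⟩) (dirac n) :=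
  fun k _ π => (tsum_dirac_mul n fun j => State.runProb k ⟨.nat, .num j, π⟩).ge

theorem lowerRel_subst {Γ : Ctx} {σ : Ty} (M : Tm Γ σ) : ∀ (s : Sub Γ []) (u : CtxWeb Γ → ℝ≥0∞),
    (∀ τ (x : Var Γ τ), LowerRel τ (fun π => State.convProb ⟨τ, s x, π⟩) (x.get u)) →
      LowerRel σ (fun π => State.convProb ⟨σ, M.subst s, π⟩) (Mor.eval u (sem M)) := by
  have cons : ∀ {Γ : Ctx} {τ : Ty} (s : Sub Γ []) (u : CtxWeb Γ → ℝ≥0∞) (N : Closed τ)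
      (y : Web τ → ℝ≥0∞),
      (∀ τ (x : Var Γ τ), LowerRel τ (fun π => State.convProb ⟨τ, s x, π⟩) (x.get u)) →
      LowerRel τ (fun π => State.convProb ⟨τ, N, π⟩) y →
      ∀ υ (x : Var (τ :: Γ) υ),
        LowerRel υ (fun π => State.convProb ⟨υ, Sub.cons N s x, π⟩) (x.get (envCons y u)) := by
    intro Γ τ s u N y hs hN υ x
    cases x with
    | zero => exact hN
    | succ x => exact hs υ x
  induction M with
  | num n => intro s u hs; rw [sem, Mor.eval_num]; exact lowerRel_num n
  | dice r =>
    intro s u hs π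
    simp only [sem, Mor.eval_dice]
    rw [tsum_dice_mul]
    exact (State.convProb_of_toss rfl).ge
  | var x => intro s u hs; rw [sem, Mor.eval_var]; exact hs _ x
  | succ M ih =>
    intro s u hs π
    simp only [sem, Mor.eval_mapNat]
    rw [tsum_mapNat_mul]
    refine le_trans (ENNReal.tsum_le_tsum fun n => mul_le_mul_right ?_ _)
      ((ih s u hs (.succ π)).trans (State.convProb_of_next rfl).ge)
    exact (State.convProb_of_next rfl).ge
  | pred M ih =>
    intro s u hs π
    simp only [sem, Mor.eval_mapNat]
    rw [tsum_mapNat_mul]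
    refine le_trans (ENNReal.tsum_le_tsum fun n => mul_le_mul_right ?_ _)
      ((ih s u hs (.pred π)).trans (State.convProb_of_next rfl).ge)
    exact (State.convProb_of_next rfl).ge
  | ifz M N P ihM ihN ihP =>
    intro s u hs
    have e : Mor.eval u (sem (.ifz M N P)) = fun b => ∑' n : ℕ, Mor.eval u (sem M) n *
        (if n = 0 then Mor.eval u (sem N) else Mor.eval u (sem P)) b := by
      funext b
      rw [sem, Mor.eval_ifz]
      exact tsum_congr fun n => by split_ifs <;> rfl
    rw [e]
    -- The intermediate functional mixes the branches with the weights denoted by `M`; the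
    -- hypothesis on `M`, at the stack with `ifz` pushed, bounds it.
    refine LowerRel.mono (φ := fun π => ∑' n : ℕ, Mor.eval u (sem M) n *
      State.convProb ⟨_, if n = 0 then N.subst s else P.subst s, π⟩) (fun π => ?_)
      (LowerRel.tsum _ fun n => ?_)
    · refine le_trans (ENNReal.tsum_le_tsum fun n => mul_le_mul_right ?_ _)
        ((ihM s u hs (.ifz (N.subst s) (P.subst s) π)).trans (State.convProb_of_next rfl).ge)
      cases n <;> exact (State.convProb_of_next rfl).ge
    · split_ifs
      · exact ihN s u hs
      · exact ihP s u hs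
  | letin M N ihM ihN =>
    intro s u hs
    have e : Mor.eval u (sem (.letin M N)) = fun b => ∑' n : ℕ, Mor.eval u (sem M) n *
        Mor.eval (envCons (dirac n) u) (sem N) b := by
      funext b
      rw [sem, Mor.eval_letin]
    rw [e]
    refine LowerRel.mono (φ := fun π => ∑' n : ℕ, Mor.eval u (sem M) n *
      State.convProb ⟨_, N.subst (Sub.cons (.num n) s), π⟩) (fun π => ?_)
      (LowerRel.tsum _ fun n => ihN _ _ (cons s u _ _ hs (lowerRel_num n)))
    refine le_trans (ENNReal.tsum_le_tsum fun n => mul_le_mul_right ?_ _)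
      ((ihM s u hs (.letin (N.subst (s.lift _)) π)).trans (State.convProb_of_next rfl).ge)
    rw [← Tm.subst_lift_inst]
    exact (State.convProb_of_next rfl).ge
  | app M N ihM ihN =>
    intro s u hs
    rw [sem, Mor.eval_app]
    exact (ihM s u hs _ _ (ihN s u hs)).mono fun π => (State.convProb_of_next rfl).ge
  | lam M ih =>
    intro s u hs N y hN
    rw [sem, Mor.kleisli_eval_lam]
    refine (ih _ _ (cons s u N y hs hN)).mono fun π => ?_
    rw [← Tm.subst_lift_inst]
    exact (State.convProb_of_next rfl).ge
  | fix M ih =>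
    intro s u hs
    rw [sem, Mor.eval_fix]
    -- Every iterate is related to the whole term `fix M`, because its unfolding feeds `fix M` back
    -- to `M`.
    refine LowerRel.iSup (kleisliIter_mono _) fun n => ?_
    induction n with
    | zero => exact LowerRel.zero _
    | succ n ihn => exact (ih s u hs _ _ ihn).mono fun π => (State.convProb_of_next rfl).ge

theorem upperRel_subst {Γ : Ctx} {σ : Ty} (M : Tm Γ σ) : ∀ (n : ℕ) (s : Sub Γ [])
    (u : CtxWeb Γ → ℝ≥0∞),
    (∀ τ (x : Var Γ τ), UpperRel τ n (fun k π => State.runProb k ⟨τ, s x, π⟩) (x.get u)) →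
      UpperRel σ n (fun k π => State.runProb k ⟨σ, M.subst s, π⟩) (Mor.eval u (sem M)) := by
  have cons : ∀ {Γ : Ctx} {τ : Ty} (n : ℕ) (s : Sub Γ []) (u : CtxWeb Γ → ℝ≥0∞) (N : Closed τ)
      (y : Web τ → ℝ≥0∞),
      (∀ τ (x : Var Γ τ), UpperRel τ n (fun k π => State.runProb k ⟨τ, s x, π⟩) (x.get u)) →
      UpperRel τ n (fun k π => State.runProb k ⟨τ, N, π⟩) y →
      ∀ υ (x : Var (τ :: Γ) υ),
        UpperRel υ n (fun k π => State.runProb k ⟨υ, Sub.cons N s x, π⟩) (x.get (envCons y u)) := by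
    intro Γ τ n s u N y hs hN υ x
    cases x with
    | zero => exact hN
    | succ x => exact hs υ x
  induction M with
  | num n => intro m s u hs; rw [sem, Mor.eval_num]; exact upperRel_num m n
  | dice r =>
    intro m s u hs k hk π
    simp only [sem, Mor.eval_dice]
    rw [tsum_dice_mul]
    exact (State.runProb_succ_le k _).trans (State.runProb_of_toss rfl k).le
  | var x => intro n s u hs; rw [sem, Mor.eval_var]; exact hs _ x
  | succ M ih =>
    intro m s u hs k hk π
    simp only [sem, Mor.eval_mapNat]
    rw [tsum_mapNat_mul]
    refine le_trans ((State.runProb_le_of_next rfl k).trans (ih m s u hs k hk (.succ π)))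
      (ENNReal.tsum_le_tsum fun n => mul_le_mul_right ?_ _)
    exact State.runProb_le_of_next rfl k
  | pred M ih =>
    intro m s u hs k hk π
    simp only [sem, Mor.eval_mapNat]
    rw [tsum_mapNat_mul]
    refine le_trans ((State.runProb_le_of_next rfl k).trans (ih m s u hs k hk (.pred π)))
      (ENNReal.tsum_le_tsum fun n => mul_le_mul_right ?_ _)
    exact State.runProb_le_of_next rfl k
  | ifz M N P ihM ihN ihP =>
    intro m s u hs
    have e : Mor.eval u (sem (.ifz M N P)) = fun b => ∑' n : ℕ, Mor.eval u (sem M) n *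
        (if n = 0 then Mor.eval u (sem N) else Mor.eval u (sem P)) b := by
      funext b
      rw [sem, Mor.eval_ifz]
      exact tsum_congr fun n => by split_ifs <;> rfl
    rw [e]
    refine UpperRel.anti (Ψ := fun k π => ∑' n : ℕ, Mor.eval u (sem M) n *
      State.runProb k ⟨_, if n = 0 then N.subst s else P.subst s, π⟩) (fun k hk π => ?_)
      (UpperRel.tsum _ fun n => ?_)
    · refine le_trans ((State.runProb_le_of_next rfl k).trans
        (ihM m s u hs k hk (.ifz (N.subst s) (P.subst s) π)))
        (ENNReal.tsum_le_tsum fun n => mul_le_mul_right ?_ _)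
      cases n <;> exact State.runProb_le_of_next rfl k
    · split_ifs
      · exact ihN m s u hs
      · exact ihP m s u hs
  | letin M N ihM ihN =>
    intro m s u hs
    have e : Mor.eval u (sem (.letin M N)) = fun b => ∑' n : ℕ, Mor.eval u (sem M) n *
        Mor.eval (envCons (dirac n) u) (sem N) b := by
      funext b
      rw [sem, Mor.eval_letin]
    rw [e]
    refine UpperRel.anti (Ψ := fun k π => ∑' n : ℕ, Mor.eval u (sem M) n *
      State.runProb k ⟨_, N.subst (Sub.cons (.num n) s), π⟩) (fun k hk π => ?_)
      (UpperRel.tsum _ fun n => ihN m _ _ (cons m s u _ _ hs (upperRel_num m n)))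
    refine le_trans ((State.runProb_le_of_next rfl k).trans
      (ihM m s u hs k hk (.letin (N.subst (s.lift _)) π)))
      (ENNReal.tsum_le_tsum fun n => mul_le_mul_right ?_ _)
    rw [← Tm.subst_lift_inst]
    exact State.runProb_le_of_next rfl k
  | app M N ihM ihN =>
    intro m s u hs
    rw [sem, Mor.eval_app]
    exact (ihM m s u hs m le_rfl _ _ (ihN m s u hs)).anti fun k _ π =>
      State.runProb_le_of_next rfl k
  | lam M ih =>
    intro m s u hs n hn N y hN
    rw [sem, Mor.kleisli_eval_lam]
    refine (ih n _ _ (cons n s u N y (fun τ x => (hs τ x).of_le hn) hN)).anti fun k _ π => ?_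
    rw [← Tm.subst_lift_inst]
    exact State.runProb_le_of_next rfl k
  | fix M ih =>
    intro m s u hs
    rw [sem, Mor.eval_fix]
    have hM := ih m s u hs
    clear hs
    induction m with
    | zero => exact UpperRel.zero _ fun π => rfl
    | succ m ihm =>
      -- `fix M` at index `m` is a legitimate argument for `M`; the supremum of the iterates being a
      -- fixed point, the result has the same denotation, now at index `m + 1`.
      have h := hM m (Nat.le_succ m) _ _ (ihm (hM.of_le (Nat.le_succ m)))
      rw [kleisli_iSup_iter] at h
      exact h.succ (fun π => rfl) fun k π => (State.runProb_of_next rfl k).le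

/-- On the empty stack the numeral `0` succeeds surely and the others never, so both ground
relations collapse to the coefficient at `0`. -/
theorem convProb_eq_den (M : Closed .nat) : State.convProb ⟨.nat, M, .nil⟩ = den M (0 : ℕ) := by
  have halt : ∀ k, State.runProb (k + 1) ⟨.nat, .num 0, .nil⟩ = 1 := fun k => rfl
  have hle : ∀ k, State.runProb k ⟨.nat, .num 0, .nil⟩ ≤ 1 := fun k => by
    cases k with
    | zero => exact zero_le
    | succ k => exact (halt k).le
  have stuck : ∀ j k, State.runProb k ⟨.nat, .num (j + 1), .nil⟩ = 0 := fun j k => by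
    cases k <;> rfl
  have hsub : M.subst (fun _ x => .var x) = M := M.subst_var
  have hden := den_eq_eval M fun i => i.elim
  refine le_antisymm ?_ ?_
  · rw [State.convProb_eq_iSup]
    refine iSup_le fun k => ?_
    have h := upperRel_subst M k (fun _ x => .var x) (fun i => i.elim) (fun τ x => nomatch x)
      k le_rfl .nil
    rw [hsub, ← hden, tsum_eq_zero_add' ENNReal.summable] at h
    simp only [stuck, mul_zero, tsum_zero, add_zero] at h
    exact h.trans (mul_le_of_le_one_right' (hle k))
  · have h := lowerRel_subst M (fun _ x => .var x) (fun i => i.elim) (fun τ x => nomatch x) .nil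
    rw [hsub, ← hden] at h
    refine le_trans ?_ ((ENNReal.le_tsum 0).trans h)
    refine le_mul_of_one_le_right' ((halt 0).ge.trans (State.runProb_le_convProb 1 _))

/-! ## Terms denote elements of their probabilistic coherence space -/

namespace IsPCS

variable {I J : Type} {P : Set (I → ℝ≥0∞)} {Q : Set (J → ℝ≥0∞)}

theorem mem_of_pairing_le (h : IsPCS P) {x : I → ℝ≥0∞} (hx : ∀ y ∈ orth P, pairing y x ≤ 1) :
    x ∈ P := by
  rw [← h.biorth]
  exact hx

theorem zero_mem (h : IsPCS P) : (0 : I → ℝ≥0∞) ∈ P :=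
  h.mem_of_pairing_le fun y _ => by simp [pairing]

/-- A set equal to its bipolar is closed under subconvex combinations, since pairing is linear. -/
theorem tsum_mem (h : IsPCS P) {ι : Type} {a : ι → ℝ≥0∞} (ha : ∑' i, a i ≤ 1)
    {x : ι → I → ℝ≥0∞} (hx : ∀ i, x i ∈ P) : (fun b => ∑' i, a i * x i b) ∈ P := by
  refine h.mem_of_pairing_le fun y hy => ?_
  rw [pairing]
  simp only [← ENNReal.tsum_mul_left]
  rw [ENNReal.tsum_comm]
  refine le_trans (ENNReal.tsum_le_tsum fun i => ?_) ha
  calc ∑' b, y b * (a i * x i b) = a i * pairing (x i) y := by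
        rw [pairing, ← ENNReal.tsum_mul_left]
        exact tsum_congr fun b => by ring
    _ ≤ a i := mul_le_of_le_one_right' (hy _ (hx i))

theorem add_mem (h : IsPCS P) {a b : ℝ≥0∞} (hab : a + b ≤ 1) {x y : I → ℝ≥0∞} (hx : x ∈ P)
    (hy : y ∈ P) : (fun i => a * x i + b * y i) ∈ P := by
  have := h.tsum_mem (a := fun i : Bool => cond i a b) (by simpa [tsum_bool, add_comm] using hab)
    (x := fun i => cond i x y) (by rintro (_ | _) <;> assumption)
  simpa [tsum_bool, add_comm] using this

theorem iSup_mem (h : IsPCS P) {x : ℕ → I → ℝ≥0∞} (hmono : Monotone x) (hx : ∀ n, x n ∈ P) :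
    (⨆ n, x n) ∈ P := by
  refine h.mem_of_pairing_le fun y hy => ?_
  simp only [pairing, iSup_apply, ENNReal.mul_iSup]
  rw [tsum_iSup_of_monotone (f := fun n i => y i * x n i)
    fun i m n hmn => mul_le_mul_right (hmono hmn i) _]
  refine iSup_le fun n => ?_
  exact le_trans (tsum_congr fun i => mul_comm _ _).le (hy _ (hx n))

/-- Promotions suffice as tests: the transpose of `t` sends the orthogonal of `Q` into the
orthogonal of the promotions, which a bipolar element respects by definition. -/
theorem mem_linSpace_exclSpace (hQ : IsPCS Q) {t : (I →₀ ℕ) × J → ℝ≥0∞}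
    (h : ∀ x ∈ P, kleisli t x ∈ Q) : t ∈ linSpace (exclSpace P) Q := by
  intro v hv
  refine hQ.mem_of_pairing_le fun y hy => ?_
  have e : ∀ v, pairing y (matApp t v) = pairing v fun μ => ∑' j, t (μ, j) * y j := by
    intro v
    simp only [pairing, matApp, ← ENNReal.tsum_mul_left]
    rw [ENNReal.tsum_comm]
    exact tsum_congr fun μ => tsum_congr fun j => by ring
  rw [e, pairing_comm]
  refine hv _ ?_
  rintro _ ⟨x, hx, rfl⟩
  rw [← e, pairing_comm]
  exact hy _ (h x hx)

end IsPCS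

theorem kleisli_mem {I J : Type} {P : Set (I → ℝ≥0∞)} {Q : Set (J → ℝ≥0∞)}
    {t : (I →₀ ℕ) × J → ℝ≥0∞} (ht : t ∈ linSpace (exclSpace P) Q) {x : I → ℝ≥0∞} (hx : x ∈ P) :
    kleisli t x ∈ Q :=
  ht _ (subset_biorth _ ⟨x, hx, rfl⟩)

theorem dirac_mem (n : ℕ) : dirac n ∈ natSpace := by
  have := tsum_dirac_mul n fun _ => 1
  simp only [mul_one] at this
  exact this.le

theorem eval_sem_mem {Γ : Ctx} {σ : Ty} (M : Tm Γ σ) : ∀ u : CtxWeb Γ → ℝ≥0∞,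
    (∀ τ (x : Var Γ τ), x.get u ∈ tySem τ) → Mor.eval u (sem M) ∈ tySem σ := by
  have cons : ∀ {Γ : Ctx} {τ : Ty} (u : CtxWeb Γ → ℝ≥0∞) (y : Web τ → ℝ≥0∞),
      (∀ τ (x : Var Γ τ), x.get u ∈ tySem τ) → y ∈ tySem τ →
      ∀ υ (x : Var (τ :: Γ) υ), x.get (envCons y u) ∈ tySem υ := by
    intro Γ τ u y hu hy υ x
    cases x with
    | zero => exact hy
    | succ x => exact hu υ x
  have mapNat : ∀ {Γ : Ctx} (u : CtxWeb Γ → ℝ≥0∞) (f : ℕ → ℕ) (A : Mor Γ .nat),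
      Mor.eval u A ∈ tySem .nat → Mor.eval u (Mor.mapNat f A) ∈ tySem .nat := by
    intro Γ u f A hA
    have := tsum_mapNat_mul f (Mor.eval u A) fun _ => 1
    simp only [mul_one, ← Mor.eval_mapNat] at this
    exact this.le.trans hA
  induction M with
  | num n => intro u hu; rw [sem, Mor.eval_num]; exact dirac_mem n
  | dice r =>
    intro u hu
    have := tsum_dice_mul r fun _ => 1
    simp only [mul_one, one_mul, r.prob_add, ← Mor.eval_dice u] at this
    exact this.le
  | var x => intro u hu; rw [sem, Mor.eval_var]; exact hu _ x
  | succ M ih => intro u hu; exact mapNat u _ _ (ih u hu)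
  | pred M ih => intro u hu; exact mapNat u _ _ (ih u hu)
  | ifz M N P ihM ihN ihP =>
    intro u hu
    refine Set.mem_of_eq_of_mem (funext fun b => ?_) ((isPCS_tySem _).tsum_mem (ihM u hu)
      (x := fun n : ℕ => if n = 0 then Mor.eval u (sem N) else Mor.eval u (sem P)) fun n => ?_)
    · rw [sem, Mor.eval_ifz]
      exact tsum_congr fun n => by split_ifs <;> rfl
    · split_ifs
      · exact ihN u hu
      · exact ihP u hu
  | letin M N ihM ihN =>
    intro u hu
    exact Set.mem_of_eq_of_mem (funext fun b => Mor.eval_letin u (sem M) (sem N) b)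
      ((isPCS_tySem _).tsum_mem (ihM u hu) fun n => ihN _ (cons u _ hu (dirac_mem n)))
  | app M N ihM ihN =>
    intro u hu
    rw [sem, Mor.eval_app]
    exact kleisli_mem (ihM u hu) (ihN u hu)
  | lam M ih =>
    intro u hu
    refine (isPCS_tySem _).mem_linSpace_exclSpace fun x hx => ?_
    rw [sem, Mor.kleisli_eval_lam]
    exact ih _ (cons u x hu hx)
  | fix M ih =>
    intro u hu
    rw [sem, Mor.eval_fix]
    refine (isPCS_tySem _).iSup_mem (kleisliIter_mono _) fun n => ?_
    induction n with
    | zero => exact (isPCS_tySem _).zero_mem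
    | succ n ihn => exact kleisli_mem (ih u hu) ihn

theorem den_mem {σ : Ty} (M : Closed σ) : den M ∈ tySem σ := by
  rw [den_eq_eval M fun i => i.elim]
  exact eval_sem_mem M _ fun τ x => nomatch x

/-! ## The tamed contexts -/

theorem den_app {σ τ : Ty} (M : Closed (.arr σ τ)) (N : Closed σ) :
    den (.app M N) = kleisli (den M) (den N) := by
  have u : CtxWeb [] → ℝ≥0∞ := fun i => i.elim
  rw [den_eq_eval _ u, den_eq_eval _ u, den_eq_eval _ u, sem, Mor.eval_app]

/-- The iterates of the identity starting from `0` remain `0`. -/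
theorem den_loop (σ : Ty) : den (loop σ) = 0 := by
  have u : CtxWeb [] → ℝ≥0∞ := fun i => i.elim
  have id : ∀ x, kleisli (Mor.eval u (sem (.lam (.var .zero) : Closed (.arr σ σ)))) x = x := by
    intro x
    rw [sem, Mor.kleisli_eval_lam, sem, Mor.eval_var]
    rfl
  have h : ∀ n, kleisliIter (Mor.eval u (sem (.lam (.var .zero) : Closed (.arr σ σ)))) n = 0 := by
    intro n
    induction n with
    | zero => rfl
    | succ n ih => rw [kleisliIter, id, ih]
  rw [den_eq_eval _ u, loop, sem, Mor.eval_fix]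
  simp [h]

theorem den_ifz_dice_loop {σ : Ty} (p : Coin) (M : Closed σ) :
    den (.ifz (.dice p) M (loop σ)) = fun b => (p.prob₀ : ℝ≥0∞) * den M b := by
  have u : CtxWeb [] → ℝ≥0∞ := fun i => i.elim
  funext b
  rw [den_eq_eval _ u, sem, Mor.eval_ifz]
  simp only [sem, Mor.eval_dice]
  rw [tsum_dice_mul, ← den_eq_eval, ← den_eq_eval, den_loop]
  simp [mul_comm]

theorem convProb_tamed {σ : Ty} (p : Coin) (C : Closed (.arr σ .nat)) (M : Closed σ) :
    State.convProb ⟨.nat, .app (tamed p C) M, .nil⟩ =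
      kleisli (den C) (fun b => (p.prob₀ : ℝ≥0∞) * den M b) (0 : ℕ) := by
  -- One transition pushes `M`, the next is the β-step, which leaves the closed term `C` unchanged.
  have h : State.convProb ⟨.nat, .app (tamed p C) M, .nil⟩ =
      State.convProb ⟨.nat, .app ((C.weaken σ).inst M) (.ifz (.dice p) M (loop σ)), .nil⟩ :=
    (State.convProb_of_next rfl).trans (State.convProb_of_next rfl)
  rw [h, Tm.weaken_inst, convProb_eq_den, den_app, den_ifz_dice_loop]

/-! ## The estimate -/

/-- Monomials are convex along rays with nonnegative direction. The increment `d` is a witness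
rather than a difference, because values may be infinite. -/
theorem promotion_convex {I : Type} {c : ℝ≥0∞} (hc : c ≤ 1) (a b : I → ℝ≥0∞) (μ : I →₀ ℕ) :
    ∃ d, promotion (fun i => a i + b i) μ = promotion a μ + d ∧
      promotion (fun i => a i + c * b i) μ ≤ promotion a μ + c * d := by
  classical
  -- The property is stable under products; `c ≤ 1` absorbs the second-order term `c * (d * e)`.
  have mul : ∀ {f g d e f' g' f'' g'' : ℝ≥0∞}, f' = f + d → f'' ≤ f + c * d → g' = g + e →
      g'' ≤ g + c * e → ∃ k, f' * g' = f * g + k ∧ f'' * g'' ≤ f * g + c * k := by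
    intro f g d e f' g' f'' g'' h₁ h₂ h₃ h₄
    refine ⟨f * e + d * g + d * e, by rw [h₁, h₃]; ring, ?_⟩
    calc f'' * g'' ≤ (f + c * d) * (g + c * e) := mul_le_mul' h₂ h₄
      _ = f * g + c * (f * e + d * g + c * (d * e)) := by ring
      _ ≤ f * g + c * (f * e + d * g + 1 * (d * e)) := by gcongr
      _ = f * g + c * (f * e + d * g + d * e) := by rw [one_mul]
  have pow : ∀ i k, ∃ d, (a i + b i) ^ k = a i ^ k + d ∧
      (a i + c * b i) ^ k ≤ a i ^ k + c * d := by
    intro i k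
    induction k with
    | zero => exact ⟨0, by simp, by simp⟩
    | succ k ih =>
      obtain ⟨d, h₁, h₂⟩ := ih
      simp only [pow_succ]
      exact mul h₁ h₂ rfl le_rfl
  induction μ using Finsupp.induction with
  | zero => exact ⟨0, by simp [promotion_zero], by simp [promotion_zero]⟩
  | single_add i k μ _ _ ih =>
    obtain ⟨d, h₁, h₂⟩ := ih
    obtain ⟨e, h₃, h₄⟩ := pow i k
    simp only [promotion_add, promotion_single]
    exact mul h₃ h₄ h₁ h₂

/-- The sum of the increments is bounded by the value at `a + b`, hence by `1`, and serves as the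
slope. -/
theorem kleisli_convex {I J : Type} {c : ℝ≥0∞} (hc : c ≤ 1) (t : (I →₀ ℕ) × J → ℝ≥0∞)
    (a b : I → ℝ≥0∞) (j : J) (h : kleisli t (fun i => a i + b i) j ≤ 1) :
    kleisli t (fun i => a i + c * b i) j ≤ kleisli t a j + c := by
  choose d hd hd' using promotion_convex hc a b
  have h₁ : kleisli t (fun i => a i + b i) j = kleisli t a j + ∑' μ, t (μ, j) * d μ := by
    simp only [kleisli, matApp, hd, mul_add, ENNReal.tsum_add]
  have h₂ : ∑' μ, t (μ, j) * d μ ≤ 1 := le_trans (by rw [h₁]; exact le_add_self) h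
  calc kleisli t (fun i => a i + c * b i) j
      ≤ ∑' μ, t (μ, j) * (promotion a μ + c * d μ) :=
        ENNReal.tsum_le_tsum fun μ => mul_le_mul_right (hd' μ) _
    _ = kleisli t a j + c * ∑' μ, t (μ, j) * d μ := by
        rw [← ENNReal.tsum_mul_left, kleisli, matApp, ← ENNReal.tsum_add]
        exact tsum_congr fun μ => by ring
    _ ≤ kleisli t a j + c := by gcongr; exact mul_le_of_le_one_right' h₂

theorem IsPCS.toReal_kleisli_sub_le {I J : Type} {P : Set (I → ℝ≥0∞)} (hP : IsPCS P)
    {t : (I →₀ ℕ) × J → ℝ≥0∞} {j : J} (ht : ∀ x ∈ P, kleisli t x j ≤ 1) {q : ℝ} (hq₀ : 0 ≤ q)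
    (hq₁ : q < 1) {x z : I → ℝ≥0∞} (hx : x ∈ P) (hz : z ≤ x) :
    (kleisli t (fun i => ENNReal.ofReal q * x i) j).toReal -
      (kleisli t (fun i => ENNReal.ofReal q * z i) j).toReal ≤
        q / (1 - q) * coneNorm P (x - z) := by
  have hq : 0 < 1 - q := sub_pos.2 hq₁
  have hzP : z ∈ P := hP.lower hz hx
  have hscale : ∀ y ∈ P, kleisli t (fun i => ENNReal.ofReal q * y i) j ≤ 1 := fun y hy =>
    ht _ (hP.lower (fun i => mul_le_of_le_one_left' (ENNReal.ofReal_le_one.2 hq₁.le)) hy)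
  have key : ∀ r : ℝ, (0 < r ∧ ∃ y ∈ P, x - z = fun a => ENNReal.ofReal r * y a) →
      (kleisli t (fun i => ENNReal.ofReal q * x i) j).toReal -
        (kleisli t (fun i => ENNReal.ofReal q * z i) j).toReal ≤ q / (1 - q) * r := by
    rintro r ⟨hr, y, hy, hxy⟩
    have hc₀ : 0 ≤ q / (1 - q) * r := by positivity
    -- Convexity needs a coefficient at most `1`; otherwise the bound exceeds `1`, which already
    -- dominates the difference.
    rcases le_total 1 (q / (1 - q) * r) with hc | hc
    · have h₁ := ENNReal.toReal_mono ENNReal.one_ne_top (hscale x hx)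
      rw [ENNReal.toReal_one] at h₁
      linarith [ENNReal.toReal_nonneg (a := kleisli t (fun i => ENNReal.ofReal q * z i) j)]
    · have e : (fun i => ENNReal.ofReal q * x i) = fun i => ENNReal.ofReal q * z i +
          ENNReal.ofReal (q / (1 - q) * r) * (ENNReal.ofReal (1 - q) * y i) := by
        funext i
        have hi : x i = z i + ENNReal.ofReal r * y i := by
          rw [← congrFun hxy i]
          exact (add_tsub_cancel_of_le (hz i)).symm
        rw [hi, mul_add, ← mul_assoc, ← mul_assoc, ← ENNReal.ofReal_mul hq₀,
          ← ENNReal.ofReal_mul hc₀]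
        congr 3
        field_simp
      -- The endpoint `q·z + (1-q)·y` is a convex combination of elements of `P`, so the value there
      -- is at most `1`.
      have h := kleisli_convex (ENNReal.ofReal_le_one.2 hc) t (fun i => ENNReal.ofReal q * z i)
        (fun i => ENNReal.ofReal (1 - q) * y i) j (ht _ (hP.add_mem (by
          rw [← ENNReal.ofReal_add hq₀ hq.le]; simp) hzP hy))
      rw [← e] at h
      have hfin := ne_top_of_le_ne_top ENNReal.one_ne_top (hscale z hzP)
      have h' := ENNReal.toReal_mono (ENNReal.add_ne_top.2 ⟨hfin, ENNReal.ofReal_ne_top⟩) h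
      rw [ENNReal.toReal_add hfin ENNReal.ofReal_ne_top, ENNReal.toReal_ofReal hc₀] at h'
      linarith
  -- The set defining `coneNorm` must be nonempty for its `sInf` to be bounded below by this
  -- argument.
  have one_mem : 0 < (1 : ℝ) ∧ ∃ y ∈ P, x - z = fun a => ENNReal.ofReal 1 * y a :=
    ⟨one_pos, x - z, hP.lower (fun i => tsub_le_self) hx, by funext a; simp⟩
  -- Passing to the infimum divides by `q / (1 - q)`, so `q = 0` is treated apart: both sides
  -- vanish.
  rcases hq₀.eq_or_lt with rfl | hq₀'
  · simp
  · rw [← div_le_iff₀' (by positivity)]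
    refine le_csInf ⟨1, one_mem⟩ fun r hr => ?_
    rw [div_le_iff₀' (by positivity)]
    exact key r hr

/-- Both values lie above the one at `x ⊓ y`, so their difference is at most the larger excess, a
fortiori the sum of the two bounds. -/
theorem IsPCS.abs_toReal_kleisli_sub_le {I J : Type} {P : Set (I → ℝ≥0∞)} (hP : IsPCS P)
    {t : (I →₀ ℕ) × J → ℝ≥0∞} {j : J} (ht : ∀ x ∈ P, kleisli t x j ≤ 1) {q : ℝ} (hq₀ : 0 ≤ q)
    (hq₁ : q < 1) {x y : I → ℝ≥0∞} (hx : x ∈ P) (hy : y ∈ P) :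
    |(kleisli t (fun i => ENNReal.ofReal q * x i) j).toReal -
      (kleisli t (fun i => ENNReal.ofReal q * y i) j).toReal| ≤ q / (1 - q) * pcsDist P x y := by
  have hmono : ∀ v ∈ P, x ⊓ y ≤ v →
      (kleisli t (fun i => ENNReal.ofReal q * (x ⊓ y) i) j).toReal ≤
        (kleisli t (fun i => ENNReal.ofReal q * v i) j).toReal := by
    intro v hv hle
    refine ENNReal.toReal_mono ?_ (kleisli_mono t (fun i => mul_le_mul_right (hle i) _) j)
    refine ne_top_of_le_ne_top ENNReal.one_ne_top (ht _ (hP.lower (fun i => ?_) hv))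
    exact mul_le_of_le_one_left' (ENNReal.ofReal_le_one.2 hq₁.le)
  have hx' := hmono x hx inf_le_left
  have hy' := hmono y hy inf_le_right
  have h₁ := hP.toReal_kleisli_sub_le ht hq₀ hq₁ hx (inf_le_left : x ⊓ y ≤ x)
  have h₂ := hP.toReal_kleisli_sub_le ht hq₀ hq₁ hy (inf_le_right : x ⊓ y ≤ y)
  rw [pcsDist, mul_add, abs_le]
  constructor <;> linarith

end PPCF

theorem mainTheorem3 (p : ℚ) (hp₀ : 0 ≤ p) (hp₁ : p < 1) (σ : PPCF.Ty) (M M' : PPCF.Closed σ) :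
    PPCF.tamedObsDist ⟨p, hp₀, hp₁.le⟩ M M' ≤
      (p : ℝ) / (1 - (p : ℝ)) * PPCF.pcsDist (PPCF.tySem σ) (PPCF.den M) (PPCF.den M') := by
  refine (PPCF.tamedObsDist_isLUB _ M M').2 ?_
  rintro _ ⟨C, rfl⟩
  rw [PPCF.probZero, PPCF.probZero, PPCF.convProb_tamed, PPCF.convProb_tamed]
  refine (PPCF.isPCS_tySem σ).abs_toReal_kleisli_sub_le (fun x hx => ?_) (by exact_mod_cast hp₀)
    (by exact_mod_cast hp₁) (PPCF.den_mem M) (PPCF.den_mem M')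
  -- The coefficient at `0` is at most the total mass of a subprobability distribution.
  exact (ENNReal.le_tsum (f := PPCF.kleisli (PPCF.den C) x) (0 : ℕ)).trans
    (PPCF.kleisli_mem (PPCF.den_mem C) hx)
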